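/- **Setting.** Let $k_0\ge 2$, $d_1,\dots,d_{k_0}\ge 1$, $n_0=0$, $n_i=d_1+\dots+d_i$ and $d=n_{k_0}$. For a vector $x$, let $\mathbf x_{n_i}$ be its first $n_i$ coordinates and $\mathbf x_{[n_{i-1}+1,n_i]}$ the coordinates $n_{i-1}+1,\dots,n_i$. Let $\mathcal P(S)$ be the set of Borel probability measures on $S$. Let $\mu,\nu\in\mathcal P(\mathbb R^d)$, with marginals $\mu_i,\nu_i$ on the first $n_i$ coordinates, and let $\mu_i(d\mathbf x_{[n_{i-1}+1,n_i]}\mid \mathbf x_{n_{i-1}})$ be the regular conditional probability. *Assumptions.* - (A0,i) $p:\mathbb R^d\times\mathbb R^d\to(0,\infty)$ is continuous and $\int p(x,y)\,dy=1$ for all $x$. For $1\le i<k_0$, $p_i(\mathbf x_{n_i},\mathbf y_{n_i}):=\int_{\mathbb R^{d-n_i}}p(x,(\mathbf y_{n_i},w))\,dw$ does not depend on the coordinates of $x$ after the $n_i$-th, and is finite and continuous. Put $p_{k_0}:=p$. - (A0,iii) For $2\le i\le k_0$ there is $\psi_i\in C(\mathbb R^{d_i})$ such that $z\mapsto\log p_i(\mathbf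 x_{n_i},(\mathbf y_{n_{i-1}},z))+\psi_i(z)$ is convex for all $\mathbf x_{n_i},\mathbf y_{n_{i-1}}$. - (A1,i) $\nu$ has a density $f_\nu$. Put $f_{\nu_i}(\mathbf y_{n_i}):=\int f_\nu(\mathbf y_{n_i},w)\,dw$ for $i<k_0$ and $f_{\nu_{k_0}}:=f_\nu$. *Notation.* Let $2\le i\le k_0$. Put $$p_i(x,z\mid\mathbf y_{n_{i-1}}):=\frac{p_i(x,(\mathbf y_{n_{i-1}},z))}{\int p_i(x,(\mathbf y_{n_{i-1}},z'))\,dz'},\qquad f_{\nu_i}(z\mid\mathbf y_{n_{i-1}}):=\frac{f_{\nu_i}(\mathbf y_{n_{i-1}},z)}{f_{\nu_{i-1}}(\mathbf y_{n_{i-1}})} .$$ Let $h_j:\mathbb R^{n_j}\to[0,\infty)$, $1\le j\le i-1$, be given functions, $h_j(\mathbf y_{n_{j-1}},\cdot)$ being measurable for every $\mathbf y_{n_{j-1}}$ (for instance solutions of the Schrödinger equations of the previous levels). Put $h_j(0,\mathbf x_{n_j},\mathbf y_{n_{j-1}}):=\int h_j(\mathbf y_{n_{j-1}},z)\,p_j(\mathbf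 x_{n_j},(\mathbf y_{n_{j-1}},z))\,dz$, $$\pi_{\mu_{i-1},\nu_{i-1}}(\mathbf y_{n_{i-1}},d\mathbf x_{n_{i-1}}):=\frac1{f_{\nu_{i-1}}(\mathbf y_{n_{i-1}})}\prod_{j=1}^{i-1}\frac{h_j(\mathbf y_{n_j})\,p_j(\mathbf x_{n_j},\mathbf y_{n_j})}{h_j(0,\mathbf x_{n_j},\mathbf y_{n_{j-1}})}\,\mu_{i-1}(d\mathbf x_{n_{i-1}}),$$ $$Q_{\mathbf y_{n_{i-1}}}(d\mathbf x_{n_i}):=\pi_{\mu_{i-1},\nu_{i-1}}(\mathbf y_{n_{i-1}},d\mathbf x_{n_{i-1}})\,\mu_i(d\mathbf x_{[n_{i-1}+1,n_i]}\mid\mathbf x_{n_{i-1}}).$$ **Proposition 2.1.** Assume (A0,i), (A0,iii) and (A1,i). Let $2\le i\le k_0$, and let $\mathbf y_{n_{i-1}}$ be such that $f_{\nu_{i-1}}(\mathbf y_{n_{i-1}})>0$ and $\pi_{\mu_{i-1},\nu_{i-1}}(\mathbf y_{n_{i-1}},\cdot)$ is a probability measure. Write $Q=Q_{\mathbf y_{n_{i-1}}}$.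 1. The equation between measures on $\mathbb R^{d_i}$ $$f_{\nu_i}(z\mid\mathbf y_{n_{i-1}})\,dz=h_i(\mathbf y_{n_{i-1}},z)\,dz\int_{\mathbb R^{n_i}}\frac{p_i(x,z\mid\mathbf y_{n_{i-1}})}{\int_{\mathbb R^{d_i}}h_i(\mathbf y_{n_{i-1}},z')\,p_i(x,z'\mid\mathbf y_{n_{i-1}})\,dz'}\,Q(dx)$$ has a measurable solution $h_i(\mathbf y_{n_{i-1}},\cdot):\mathbb R^{d_i}\to[0,\infty)$. It is unique up to a multiplicative function of $\mathbf y_{n_{i-1}}$: the measurable solutions at $\mathbf y_{n_{i-1}}$ are exactly the measurable functions that agree $dz$-a.e. with a positive constant multiple of one of them. 2. For every such solution, with $h_i(0,x,\mathbf y_{n_{i-1}})$ defined as above for $j=i$, the measure $$\pi_{\mu_i,\nu_i}(\mathbf y_{n_{i-1}},dx\,dz):=\frac{h_i(\mathbf y_{n_{i-1}},z)\,p_i(x,(\mathbf y_{n_{i-1}},z))}{h_i(0,x,\mathbf y_{n_{i-1}})}\,Q(dx)\,dz$$ is a probability measure on $\mathbb R^{n_i}\times\mathbb R^{d_i}$ with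 marginals $Q$ and $f_{\nu_i}(z\mid\mathbf y_{n_{i-1}})\,dz$. 3. Suppose in addition that $h_1,\dots,h_{i-1}$ are measurable. Define inductively the measures $$\pi_{\mu_1,\nu_1}(d\mathbf x_{n_1}d\mathbf y_{n_1}):=\frac{h_1(\mathbf y_{n_1})}{\int h_1(z)p_1(\mathbf x_{n_1},z)\,dz}\,\mu_1(d\mathbf x_{n_1})\,p_1(\mathbf x_{n_1},\mathbf y_{n_1})\,d\mathbf y_{n_1},$$ $$\pi_{\mu_{j-1},\nu_{j-1}}\otimes\mu_{j|j-1}(d\mathbf x_{n_j}d\mathbf y_{n_{j-1}}):=\pi_{\mu_{j-1},\nu_{j-1}}(d\mathbf x_{n_{j-1}}d\mathbf y_{n_{j-1}})\,\mu_j(d\mathbf x_{[n_{j-1}+1,n_j]}\mid\mathbf x_{n_{j-1}}),$$ $$\pi_{0,j}(d\mathbf x_{n_j}d\mathbf y_{n_j}):=\pi_{\mu_{j-1},\nu_{j-1}}\otimes\mu_{j|j-1}(d\mathbf x_{n_j}d\mathbf y_{n_{j-1}})\,p_j(\mathbf x_{n_j},\mathbf y_{[n_{j-1}+1,n_j]}\mid\mathbf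 y_{n_{j-1}})\,d\mathbf y_{[n_{j-1}+1,n_j]},$$ $$\pi_{\mu_j,\nu_j}(d\mathbf x_{n_j}d\mathbf y_{n_j}):=\frac{h_j(\mathbf y_{n_j})}{\int h_j(\mathbf y_{n_{j-1}},z)p_j(\mathbf x_{n_j},z\mid\mathbf y_{n_{j-1}})\,dz}\,\pi_{0,j}(d\mathbf x_{n_j}d\mathbf y_{n_j}).$$ Fix versions of the regular conditional probabilities $\pi_{\mu_{i-1},\nu_{i-1}}\otimes\mu_{i|i-1}(d\mathbf x_{n_i}\mid\mathbf y_{n_{i-1}})$ and $\pi_{0,i}(d\mathbf x_{n_i}d\mathbf y_{[n_{i-1}+1,n_i]}\mid\mathbf y_{n_{i-1}})$, and suppose that at the given $\mathbf y_{n_{i-1}}$ $$\pi_{0,i}(dx\,dz\mid\mathbf y_{n_{i-1}})=\pi_{\mu_{i-1},\nu_{i-1}}\otimes\mu_{i|i-1}(dx\mid\mathbf y_{n_{i-1}})\,p_i(x,z\mid\mathbf y_{n_{i-1}})\,dz,\qquad \pi_{\mu_{i-1},\nu_{i-1}}\otimes\mu_{i|i-1}(dx\mid\mathbf y_{n_{i-1}})=Q(dx).$$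 Then, with $H$ the relative entropy, $\pi_{\mu_i,\nu_i}(\mathbf y_{n_{i-1}},\cdot)$ is the unique minimizer of $$\inf\bigl\{H\bigl(\pi\,\|\,\pi_{0,i}(\cdot\mid\mathbf y_{n_{i-1}})\bigr):\ \pi\in\mathcal P(\mathbb R^{n_i}\times\mathbb R^{d_i})\text{ with marginals }Q\text{ and }f_{\nu_i}(z\mid\mathbf y_{n_{i-1}})\,dz\bigr\},$$ provided that this infimum is finite. In particular, this holds for $f_{\nu_{i-1}}(\mathbf y_{n_{i-1}})\,d\mathbf y_{n_{i-1}}$-a.e. $\mathbf y_{n_{i-1}}$ if these conditions hold a.e. -/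

import Mathlib

open MeasureTheory ProbabilityTheory InformationTheory
open scoped ENNReal NNReal

namespace CondSchrodinger

noncomputable section

/-! ### Block coordinates

`d j` (for `1 ≤ j ≤ k`) are the block sizes, `nn d i = d 1 + ⋯ + d i`, and the ambient dimension is
`nn d k`. -/

/-- The partial sums `n_i = d_1 + ⋯ + d_i`. -/
def nn (d : ℕ → ℕ) : ℕ → ℕ
  | 0 => 0
  | i + 1 => nn d i + d (i + 1)

theorem nn_mono (d : ℕ → ℕ) {i j : ℕ} (h : i ≤ j) : nn d i ≤ nn d j :=
  monotone_nat_of_le_succ (f := nn d) (fun _ => Nat.le_add_right _ _) h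

/-- `ℝ^{n_i}`. -/
abbrev E (d : ℕ → ℕ) (i : ℕ) : Type := Fin (nn d i) → ℝ

/-- `ℝ^{d_i}`. -/
abbrev B (d : ℕ → ℕ) (i : ℕ) : Type := Fin (d i) → ℝ

/-- The coordinates `ℝ^{D - n_i}` that follow the first `n_i` ones in `ℝ^D`, `D = n_k`. -/
abbrev Tail (d : ℕ → ℕ) (k i : ℕ) : Type := Fin (nn d k - nn d i) → ℝ

/-- `(y, z) ∈ ℝ^{n_{i+1}}` for `y ∈ ℝ^{n_i}`, `z ∈ ℝ^{d_{i+1}}`. -/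
def join {d : ℕ → ℕ} {i : ℕ} (y : E d i) (z : B d (i + 1)) : E d (i + 1) :=
  Fin.append y z

/-- `(y, w) ∈ ℝ^{n_k}` for `y ∈ ℝ^{n_i}`, `w ∈ ℝ^{n_k - n_i}`. -/
def glue {d : ℕ → ℕ} {k i : ℕ} (y : E d i) (w : Tail d k i) : E d k := fun j =>
  if hj : (j : ℕ) < nn d i then y ⟨j, hj⟩ else w ⟨j - nn d i, by have := j.2; omega⟩

/-- The first `n_i` coordinates of a point of `ℝ^{n_j}`, `i ≤ j`. -/
def trunc {d : ℕ → ℕ} {i j : ℕ} (h : i ≤ j) (x : E d j) : E d i :=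
  fun l => x (Fin.castLE (nn_mono d h) l)

/-- The coordinates `n_i + 1, …, n_{i+1}` of a point of `ℝ^{n_{i+1}}`. -/
def lastBlock {d : ℕ → ℕ} {i : ℕ} (x : E d (i + 1)) : B d (i + 1) :=
  fun l => x (Fin.natAdd (nn d i) l)

/-! ### Marginal and conditional densities -/

/-- `p_i(x, y) = ∫ p((x, x'), (y, w)) dw`, evaluated at `x' = 0`; `DensityAssumption` below makes it
independent of `x'`, finite and continuous. For `i = k` no variable is integrated, so `p_k = p`. -/
def pMarg (d : ℕ → ℕ) (k : ℕ) (p : E d k → E d k → ℝ) (i : ℕ) (x y : E d i) : ℝ≥0∞ :=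
  ∫⁻ w : Tail d k i, ENNReal.ofReal (p (glue x 0) (glue y w))

/-- `p_{i+1}(x, z | y) = p_{i+1}(x, (y, z)) / ∫ p_{i+1}(x, (y, z')) dz'`. -/
def pCond (d : ℕ → ℕ) (k : ℕ) (p : E d k → E d k → ℝ) (i : ℕ)
    (x : E d (i + 1)) (z : B d (i + 1)) (y : E d i) : ℝ≥0∞ :=
  pMarg d k p (i + 1) x (join y z) / ∫⁻ z' : B d (i + 1), pMarg d k p (i + 1) x (join y z')

/-- `p` is a positive continuous family of probability densities on `ℝ^{n_k}`, and for `1 ≤ i < k`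
the marginal `p_i` does not depend on the coordinates of `x` after the `n_i`-th one, and is finite
and continuous. -/
structure DensityAssumption (d : ℕ → ℕ) (k : ℕ) (p : E d k → E d k → ℝ) : Prop where
  cont : Continuous (Function.uncurry p)
  pos : ∀ x y, 0 < p x y
  prob : ∀ x, ∫⁻ y, ENNReal.ofReal (p x y) = 1
  indep : ∀ i, 1 ≤ i → ∀ hi : i < k, ∀ x x' : E d k, trunc hi.le x = trunc hi.le x' →
    ∀ y : E d i, ∫⁻ w : Tail d k i, ENNReal.ofReal (p x (glue y w)) =
      ∫⁻ w : Tail d k i, ENNReal.ofReal (p x' (glue y w))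
  marg_finite : ∀ i, 1 ≤ i → i < k → ∀ x y, pMarg d k p i x y ≠ ∞
  marg_cont : ∀ i, 1 ≤ i → i < k → Continuous (Function.uncurry (pMarg d k p i))

/-- For `2 ≤ i + 1 ≤ k` there is a continuous `ψ` on `ℝ^{d_{i+1}}` such that
`z ↦ log p_{i+1}(x, (y, z)) + ψ(z)` is convex for all `x`, `y`. -/
def ConvexityAssumption (d : ℕ → ℕ) (k : ℕ) (p : E d k → E d k → ℝ) : Prop :=
  ∀ i, 1 ≤ i → i + 1 ≤ k → ∃ ψ : B d (i + 1) → ℝ, Continuous ψ ∧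
    ∀ (x : E d (i + 1)) (y : E d i), ConvexOn ℝ Set.univ
      (fun z => Real.log (pMarg d k p (i + 1) x (join y z)).toReal + ψ z)

/-- `f` is a (Borel) density of `ν`. -/
def HasDensity {d : ℕ → ℕ} {k : ℕ} (ν : Measure (E d k)) (f : E d k → ℝ≥0) : Prop :=
  Measurable f ∧ ν = volume.withDensity (fun y => (f y : ℝ≥0∞))

/-- `f_{ν_i}(y) = ∫ f(y, w) dw`; for `i = k` this is `f`. -/
def fMarg (d : ℕ → ℕ) (k : ℕ) (f : E d k → ℝ≥0) (i : ℕ) (y : E d i) : ℝ≥0∞ :=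
  ∫⁻ w : Tail d k i, (f (glue y w) : ℝ≥0∞)

/-- `f_{ν_{i+1}}(z | y) = f_{ν_{i+1}}(y, z) / f_{ν_i}(y)`. -/
def fCond (d : ℕ → ℕ) (k : ℕ) (f : E d k → ℝ≥0) (i : ℕ) (y : E d i) (z : B d (i + 1)) : ℝ≥0∞ :=
  fMarg d k f (i + 1) (join y z) / fMarg d k f i y

/-- The probability measure `f_{ν_{i+1}}(z | y) dz` on `ℝ^{d_{i+1}}`. -/
def targetCond (d : ℕ → ℕ) (k : ℕ) (f : E d k → ℝ≥0) (i : ℕ) (y : E d i) : Measure (B d (i + 1)) :=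
  volume.withDensity (fCond d k f i y)

/-- The marginal `μ_i` of `μ` on the first `n_i` coordinates. -/
def muMarg {d : ℕ → ℕ} {k : ℕ} (μ : Measure (E d k)) (i : ℕ) (hi : i ≤ k) : Measure (E d i) :=
  μ.map (trunc hi)

/-- The regular conditional probability
`μ_{i+1}(dx_{[n_i + 1, n_{i+1}]} | x_{n_i})`. -/
def muCond {d : ℕ → ℕ} {k : ℕ} (μ : Measure (E d k)) [IsFiniteMeasure μ] (i : ℕ)
    (hi : i + 1 ≤ k) : Kernel (E d i) (B d (i + 1)) :=
  condDistrib (fun x : E d k => lastBlock (trunc hi x)) (trunc (Nat.le_of_succ_le hi)) μ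

/-! ### The conditional measures -/

/-- `h_{i+1}(0, x, y) = ∫ g(z) p_{i+1}(x, (y, z)) dz`, where `g = h_{i+1}(y, ·)`. -/
def hZero (d : ℕ → ℕ) (k : ℕ) (p : E d k → E d k → ℝ) (i : ℕ) (g : B d (i + 1) → ℝ≥0)
    (x : E d (i + 1)) (y : E d i) : ℝ≥0∞ :=
  ∫⁻ z, (g z : ℝ≥0∞) * pMarg d k p (i + 1) x (join y z)

/-- The factor `h_{j+1}(y) p_{j+1}(x, y) / h_{j+1}(0, x, y_{n_j})` for `x, y ∈ ℝ^{n_{j+1}}`. -/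
def factor (d : ℕ → ℕ) (k : ℕ) (p : E d k → E d k → ℝ) (h : (j : ℕ) → E d j → ℝ≥0) (j : ℕ)
    (x y : E d (j + 1)) : ℝ≥0∞ :=
  (h (j + 1) y : ℝ≥0∞) * pMarg d k p (j + 1) x y /
    hZero d k p j (fun z => h (j + 1) (join (trunc (Nat.le_succ j) y) z)) x
      (trunc (Nat.le_succ j) y)

/-- `π_{μ_i,ν_i}(y, dx)
  = f_{ν_i}(y)⁻¹ ∏_{j=1}^i h_j(y_{n_j}) p_j(x_{n_j}, y_{n_j}) / h_j(0, x_{n_j}, y_{n_{j-1}}) μ_i(dx)`,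
a measure on `ℝ^{n_i}` for each `y ∈ ℝ^{n_i}`. -/
def piCond (d : ℕ → ℕ) (k : ℕ) (p : E d k → E d k → ℝ) (μ : Measure (E d k)) (f : E d k → ℝ≥0)
    (h : (j : ℕ) → E d j → ℝ≥0) (i : ℕ) (hi : i ≤ k) (y : E d i) : Measure (E d i) :=
  (muMarg μ i hi).withDensity (fun x => (fMarg d k f i y)⁻¹ *
    ∏ j : Fin i, factor d k p h j (trunc (Nat.succ_le_of_lt j.2) x)
      (trunc (Nat.succ_le_of_lt j.2) y))

/-- `π_{μ_i,ν_i} ⊗ μ_{i+1|i}(y, dx)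
  = π_{μ_i,ν_i}(y, dx_{n_i}) μ_{i+1}(dx_{[n_i + 1, n_{i+1}]} | x_{n_i})`,
a measure on `ℝ^{n_{i+1}}` for each `y ∈ ℝ^{n_i}`. -/
def sourceCond (d : ℕ → ℕ) (k : ℕ) (p : E d k → E d k → ℝ) (μ : Measure (E d k))
    [IsFiniteMeasure μ] (f : E d k → ℝ≥0) (h : (j : ℕ) → E d j → ℝ≥0) (i : ℕ) (hi : i + 1 ≤ k)
    (y : E d i) : Measure (E d (i + 1)) :=
  (piCond d k p μ f h i (Nat.le_of_succ_le hi) y ⊗ₘ muCond μ i hi).map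
    (fun q => join q.1 q.2)

/-- `g = h_{i+1}(y, ·) : ℝ^{d_{i+1}} → [0, ∞)` is a measurable solution of the conditional
Schrödinger equation at `y`, an equality of measures on `ℝ^{d_{i+1}}`:
`f(z | y) dz = g(z) dz ∫ p(x, z | y) / (∫ g(z') p(x, z' | y) dz') Q(dx)`. Here `Q` stands for
`π_{μ_i,ν_i} ⊗ μ_{i+1|i}(y, ·)`. -/
def IsSolution (d : ℕ → ℕ) (k : ℕ) (p : E d k → E d k → ℝ) (f : E d k → ℝ≥0) (i : ℕ)
    (y : E d i) (Q : Measure (E d (i + 1))) (g : B d (i + 1) → ℝ≥0) : Prop :=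
  Measurable g ∧
  targetCond d k f i y = volume.withDensity (fun z => (g z : ℝ≥0∞) *
    ∫⁻ x, pCond d k p i x z y / (∫⁻ z', (g z' : ℝ≥0∞) * pCond d k p i x z' y) ∂Q)

/-- `π_{μ_{i+1},ν_{i+1}}(y, dx dz) = g(z) p_{i+1}(x, (y, z)) / h_{i+1}(0, x, y) Q(dx) dz`, where
`g = h_{i+1}(y, ·)` and `Q` stands for `π_{μ_i,ν_i} ⊗ μ_{i+1|i}(y, ·)`. -/
def planCond (d : ℕ → ℕ) (k : ℕ) (p : E d k → E d k → ℝ) (i : ℕ)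
    (y : E d i) (Q : Measure (E d (i + 1))) (g : B d (i + 1) → ℝ≥0) :
    Measure (E d (i + 1) × B d (i + 1)) :=
  (Q.prod volume).withDensity (fun q =>
    (g q.2 : ℝ≥0∞) * pMarg d k p (i + 1) q.1 (join y q.2) / hZero d k p i g q.1 y)

/-! ### Couplings and the entropy problem -/

/-- `𝒜(P, Q)`: the probability measures with marginals `P` and `Q`. -/
def couplings {α β : Type*} [MeasurableSpace α] [MeasurableSpace β] (P : Measure α)
    (Q : Measure β) : Set (Measure (α × β)) :=
  {π | IsProbabilityMeasure π ∧ π.map Prod.fst = P ∧ π.map Prod.snd = Q}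

/-- `inf {H(π ‖ R) : π ∈ 𝒜(P, Q)}`, with `H` the relative entropy. -/
def entropyValue {α β : Type*} [MeasurableSpace α] [MeasurableSpace β] (P : Measure α)
    (Q : Measure β) (R : Measure (α × β)) : ℝ≥0∞ :=
  ⨅ π ∈ couplings P Q, klDiv π R

/-- `m` is the unique minimizer of `H(· ‖ R)` on `𝒜(P, Q)`. -/
def IsUniqueMinimizer {α β : Type*} [MeasurableSpace α] [MeasurableSpace β] (P : Measure α)
    (Q : Measure β) (R : Measure (α × β)) (m : Measure (α × β)) : Prop :=
  m ∈ couplings P Q ∧ klDiv m R = entropyValue P Q R ∧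
    ∀ π ∈ couplings P Q, klDiv π R = entropyValue P Q R → π = m

/-! ### The joint measures -/

/-- `π ⊗ μ_{i+1|i}(dx_{n_{i+1}} dy_{n_i})
  = π(dx_{n_i} dy_{n_i}) μ_{i+1}(dx_{[n_i + 1, n_{i+1}]} | x_{n_i})`. -/
def extend {d : ℕ → ℕ} {k : ℕ} (μ : Measure (E d k)) [IsFiniteMeasure μ] (i : ℕ)
    (hi : i + 1 ≤ k) (π : Measure (E d i × E d i)) : Measure (E d (i + 1) × E d i) :=
  (π ⊗ₘ Kernel.prodMkRight (E d i) (muCond μ i hi)).map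
    (fun q => (join q.1.1 q.2, q.1.2))

/-- `π ⊗ μ_{i+1|i}(dx_{n_{i+1}} dy_{n_i}) p_{i+1}(x, z | y) dz`, as a measure in
`(x, (y, z)) ∈ ℝ^{n_{i+1}} × ℝ^{n_{i+1}}`. -/
def reference (d : ℕ → ℕ) (k : ℕ) (p : E d k → E d k → ℝ) (μ : Measure (E d k))
    [IsFiniteMeasure μ] (i : ℕ) (hi : i + 1 ≤ k) (π : Measure (E d i × E d i)) :
    Measure (E d (i + 1) × E d (i + 1)) :=
  (((extend μ i hi π).prod volume).withDensity
    (fun q : (E d (i + 1) × E d i) × B d (i + 1) => pCond d k p i q.1.1 q.2 q.1.2)).map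
      (fun q => (q.1.1, join q.1.2 q.2))

/-- The measures `π_{μ_i,ν_i}(dx dy)` on `ℝ^{n_i} × ℝ^{n_i}`, by recursion on `i ≥ 1`:
`π_{μ_1,ν_1} = h_1(y) / (∫ h_1(z) p_1(x, z) dz) μ_1(dx) p_1(x, y) dy`, and `π_{μ_{i+1},ν_{i+1}}` has
density `h_{i+1}(y) / ∫ h_{i+1}(y_{n_i}, z) p_{i+1}(x, z | y_{n_i}) dz` with respect to
`π_{0,i+1}`, the `reference` measure built from `π_{μ_i,ν_i}`. (The value at `i = 0` is not used.) -/
def piJoint (d : ℕ → ℕ) (k : ℕ) (p : E d k → E d k → ℝ) (μ : Measure (E d k))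
    [IsFiniteMeasure μ] (h : (j : ℕ) → E d j → ℝ≥0) :
    (i : ℕ) → i ≤ k → Measure (E d i × E d i)
  | 0, _ => 0
  | 1, hi => ((muMarg μ 1 hi).prod volume).withDensity (fun q =>
      (h 1 q.2 : ℝ≥0∞) / (∫⁻ z : E d 1, (h 1 z : ℝ≥0∞) * pMarg d k p 1 q.1 z) *
        pMarg d k p 1 q.1 q.2)
  | i + 2, hi =>
      (reference d k p μ (i + 1) hi (piJoint d k p μ h (i + 1) (Nat.le_of_succ_le hi))).withDensity
        (fun q => (h (i + 2) q.2 : ℝ≥0∞) /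
          ∫⁻ z : B d (i + 2), (h (i + 2) (join (trunc (Nat.le_succ (i + 1)) q.2) z) : ℝ≥0∞) *
            pCond d k p (i + 1) q.1 z (trunc (Nat.le_succ (i + 1)) q.2))

/-- `π_{μ_i,ν_i} ⊗ μ_{i+1|i}(dx_{n_{i+1}} dy_{n_i})`. -/
def sourceJoint (d : ℕ → ℕ) (k : ℕ) (p : E d k → E d k → ℝ) (μ : Measure (E d k))
    [IsFiniteMeasure μ] (h : (j : ℕ) → E d j → ℝ≥0) (i : ℕ) (hi : i + 1 ≤ k) :
    Measure (E d (i + 1) × E d i) :=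
  extend μ i hi (piJoint d k p μ h i (Nat.le_of_succ_le hi))

/-- `π_{0,i+1}(dx_{n_{i+1}} dy_{n_{i+1}})`. -/
def pi0 (d : ℕ → ℕ) (k : ℕ) (p : E d k → E d k → ℝ) (μ : Measure (E d k))
    [IsFiniteMeasure μ] (h : (j : ℕ) → E d j → ℝ≥0) (i : ℕ) (hi : i + 1 ≤ k) :
    Measure (E d (i + 1) × E d (i + 1)) :=
  reference d k p μ i hi (piJoint d k p μ h i (Nat.le_of_succ_le hi))

/-- `κ` is a version of the regular conditional probability
`π_{μ_i,ν_i} ⊗ μ_{i+1|i}(dx_{n_{i+1}} | y_{n_i})`. -/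
def IsSourceVersion (d : ℕ → ℕ) (k : ℕ) (p : E d k → E d k → ℝ) (μ : Measure (E d k))
    [IsFiniteMeasure μ] (h : (j : ℕ) → E d j → ℝ≥0) (i : ℕ) (hi : i + 1 ≤ k)
    (κ : Kernel (E d i) (E d (i + 1))) : Prop :=
  IsMarkovKernel κ ∧ ((sourceJoint d k p μ h i hi).map Prod.swap).IsCondKernel κ

/-- `κ` is a version of the regular conditional probability
`π_{0,i+1}(dx_{n_{i+1}} dy_{[n_i + 1, n_{i+1}]} | y_{n_i})`. -/
def IsPi0Version (d : ℕ → ℕ) (k : ℕ) (p : E d k → E d k → ℝ) (μ : Measure (E d k))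
    [IsFiniteMeasure μ] (h : (j : ℕ) → E d j → ℝ≥0) (i : ℕ) (hi : i + 1 ≤ k)
    (κ : Kernel (E d i) (E d (i + 1) × B d (i + 1))) : Prop :=
  IsMarkovKernel κ ∧
    ((pi0 d k p μ h i hi).map
      (fun q => (trunc (Nat.le_succ i) q.2, (q.1, lastBlock q.2)))).IsCondKernel κ

end

end CondSchrodinger

namespace CondSchrodinger

noncomputable section

open Filter Topology BoundedContinuousFunction

/-! ### Finite Schrödinger systems -/

/-! For a fixed `y` the statement is a static Schrödinger problem: marginals `Q` and `N =
targetCond`, and the kernel `K(x, z) = p(x, z | y)`, which is positive, finite, continuous in `(x,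
z)` and of mass one in `z`. Using `pMarg` in place of `pCond` changes `K` by a factor depending on
`x` only, which the plan does not see (`DensityAssumption.planCond_eq`).

Existence. For finitely many points, a minimizer `m` of `∑ m log (m s)` with given row and column
sums makes `m s` a matrix of rank one, expressed by cross ratios. Discretizing `Q` and `N` and using
tightness, this identity, tested against products, passes to a weak limit `P` when `s` is bounded
and continuous; it then says that `s P` is a product measure. Taking `s = u v / q`, with `u v` a
continuous product minorant of `q`, gives `P = q (α ⊗ β)`. The first marginal forces `α = Q / ∫ K
dβ`, the second gives `β ≪ N`, and the density of `β` is the solution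
(`exists_schrodinger_solution`).

Uniqueness. The plans of two solutions have equal marginals, so they agree on every bounded `A(x) +
B(z)`. With `φ`, `φ'` the denominators of `g`, `g'`, suitable `A`, `B` turn the difference of the
two integrals into the integral of a positive weight times `(g' φ - g φ')²`, so `g' φ = g φ'` almost
everywhere (`IsSchrodinger.unique`).

Minimality. The log-density of the plan `m` with respect to the reference `R` has the form `U(z) +
V(x)`, so its integral is fixed by the marginals, and `H(π ‖ R) = H(π ‖ m) + H(m ‖ R)` for every
coupling of finite entropy (`klDiv_eq_klDiv_add_klDiv`). The delicate point is that `U` and `V` need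
not be integrable separately (`integral_add_eq_of_marginals`). -/

/-- Tangent-line inequality for the convex function `b ↦ b * log (b * s)`. -/
theorem mul_log_tangent_le {a b s : ℝ} (ha : 0 < a) (hb : 0 ≤ b) (hs : 0 < s) :
    a * Real.log (a * s) + (b - a) * (Real.log (a * s) + 1) ≤ b * Real.log (b * s) := by
  rcases hb.eq_or_lt with rfl | hb
  · have : (0 : ℝ) ≤ a := ha.le
    simp only [zero_mul, zero_sub]
    nlinarith
  · have h1 : Real.log (a / b) ≤ a / b - 1 := Real.log_le_sub_one_of_pos (by positivity)
    rw [Real.log_div ha.ne' hb.ne'] at h1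
    rw [Real.log_mul ha.ne' hs.ne', Real.log_mul hb.ne' hs.ne']
    have h2 : b * (Real.log a - Real.log b) ≤ b * (a / b - 1) := by gcongr
    have h3 : b * (a / b - 1) = a - b := by field_simp
    nlinarith

/-- The nonnegative matrices with row sums `a` and column sums `b`. -/
def transportPolytope {ι κ : Type*} [Fintype ι] [Fintype κ] (a : ι → ℝ) (b : κ → ℝ) :
    Set (ι × κ → ℝ) :=
  {m | (∀ t, 0 ≤ m t) ∧ (∀ i, ∑ j, m (i, j) = a i) ∧ ∀ j, ∑ i, m (i, j) = b j}

/-- The elementary cycle supported on the rectangle `{i, i'} × {j, j'}`. -/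
def rectCycle {ι κ : Type*} [DecidableEq ι] [DecidableEq κ] (i i' : ι) (j j' : κ) (t : ι × κ) : ℝ :=
  ((if t.1 = i then 1 else 0) - if t.1 = i' then 1 else 0) *
    ((if t.2 = j then 1 else 0) - if t.2 = j' then 1 else 0)

theorem sum_rectCycle_row {ι κ : Type*} [Fintype κ] [DecidableEq ι] [DecidableEq κ] (i i' : ι) (j j' : κ) (c : ι) :
    ∑ e, rectCycle i i' j j' (c, e) = 0 := by
  change ∑ e, ((if c = i then 1 else 0) - if c = i' then 1 else 0 : ℝ) *
    ((if e = j then 1 else 0) - if e = j' then 1 else 0) = 0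
  rw [← Finset.mul_sum, Finset.sum_sub_distrib]
  simp

theorem sum_rectCycle_col {ι κ : Type*} [Fintype ι] [DecidableEq ι] [DecidableEq κ] (i i' : ι) (j j' : κ) (e : κ) :
    ∑ c, rectCycle i i' j j' (c, e) = 0 := by
  change ∑ c, ((if c = i then 1 else 0) - if c = i' then 1 else 0 : ℝ) *
    ((if e = j then 1 else 0) - if e = j' then 1 else 0) = 0
  rw [← Finset.sum_mul, Finset.sum_sub_distrib]
  simp

section Finite

variable {ι κ : Type*} [Fintype ι] [Fintype κ]

/-- Each entry is at most its row sum, so this is a closed subset of an order box. -/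
theorem isCompact_transportPolytope (a : ι → ℝ) (b : κ → ℝ) :
    IsCompact (transportPolytope a b) := by
  have hsub : transportPolytope a b ⊆ Set.Icc 0 (fun t : ι × κ => a t.1) := by
    rintro m ⟨h0, h1, -⟩
    refine ⟨h0, fun t => ?_⟩
    show m t ≤ a t.1
    rw [← h1 t.1]
    exact Finset.single_le_sum (f := fun j => m (t.1, j)) (fun j _ => h0 _) (Finset.mem_univ t.2)
  refine isCompact_Icc.of_isClosed_subset ?_ hsub
  simp only [transportPolytope, Set.ofPred_and, Set.ofPred_forall]
  refine (isClosed_iInter fun t => isClosed_le continuous_const (continuous_apply t)).inter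
    ((isClosed_iInter fun i => ?_).inter (isClosed_iInter fun j => ?_))
  · exact isClosed_eq (by fun_prop) continuous_const
  · exact isClosed_eq (by fun_prop) continuous_const

/-- Pairing with the cycle is an alternating sum over four corners; applied to logarithms it is the
logarithm of a cross ratio. -/
theorem sum_mul_rectCycle [DecidableEq ι] [DecidableEq κ] (i i' : ι) (j j' : κ)
    (F : ι × κ → ℝ) :
    ∑ t, rectCycle i i' j j' t * F t =
      F (i, j) - F (i, j') - F (i', j) + F (i', j') := by
  have h1 : ∀ c : ι, ∑ e : κ, rectCycle i i' j j' (c, e) * F (c, e) =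
      ((if c = i then 1 else 0) - if c = i' then 1 else 0 : ℝ) * (F (c, j) - F (c, j')) := by
    intro c
    have h2 : ∀ e : κ, rectCycle i i' j j' (c, e) * F (c, e) =
        ((if c = i then 1 else 0) - if c = i' then 1 else 0 : ℝ) * ((if e = j then 1 else 0) * F (c, e) -
          (if e = j' then 1 else 0) * F (c, e)) := by
      intro e; simp only [rectCycle]; ring
    simp only [h2, ← Finset.mul_sum, Finset.sum_sub_distrib]
    simp
  rw [Fintype.sum_prod_type]
  simp only [h1, sub_mul, Finset.sum_sub_distrib]
  simp
  ring

/-- Existence for a finite Schrödinger system with prescribed marginals, in terms of the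
cross ratios of the plan. -/
theorem exists_mem_transportPolytope_crossRatio {a : ι → ℝ} {b : κ → ℝ}
    (ha : ∀ i, 0 ≤ a i) (hb : ∀ j, 0 ≤ b j) (ha1 : ∑ i, a i = 1) (hb1 : ∑ j, b j = 1)
    {s : ι × κ → ℝ} (hs : ∀ t, 0 < s t) :
    ∃ m ∈ transportPolytope a b, ∀ i i' j j',
      m (i, j) * s (i, j) * (m (i', j') * s (i', j')) =
        m (i, j') * s (i, j') * (m (i', j) * s (i', j)) := by
  classical
  set Φ : (ι × κ → ℝ) → ℝ := fun m => ∑ t, m t * Real.log (m t * s t) with hΦ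
  have hcont : Continuous Φ := by
    refine continuous_finsetSum _ fun t _ => ?_
    have h1 : ∀ m : ι × κ → ℝ, m t * Real.log (m t * s t) =
        (s t)⁻¹ * ((m t * s t) * Real.log (m t * s t)) := by
      intro m; have := (hs t).ne'; field_simp
    simp only [h1]
    exact continuous_const.mul (Real.continuous_mul_log.comp (by fun_prop))
  have hne : (transportPolytope a b).Nonempty := by
    refine ⟨fun t => a t.1 * b t.2, fun t => mul_nonneg (ha _) (hb _), fun i => ?_, fun j => ?_⟩
    · simp [← Finset.mul_sum, hb1]
    · simp [← Finset.sum_mul, ha1]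
  obtain ⟨m, hm, hmin⟩ :=
    (isCompact_transportPolytope a b).exists_isMinOn hne hcont.continuousOn
  have key : ∀ i i' j j', i ≠ i' → j ≠ j' →
      m (i, j') * s (i, j') * (m (i', j) * s (i', j)) ≤
        m (i, j) * s (i, j) * (m (i', j') * s (i', j')) := by
    intro i i' j j' hii hjj
    by_contra! hlt
    have hp2 : 0 < m (i, j') := (hm.1 _).lt_of_ne' fun h0 => by
      rw [h0] at hlt
      have := mul_nonneg (mul_nonneg (hm.1 (i, j)) (hs (i, j)).le)
        (mul_nonneg (hm.1 (i', j')) (hs (i', j')).le)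
      simp only [zero_mul] at hlt; linarith
    have hp3 : 0 < m (i', j) := (hm.1 _).lt_of_ne' fun h0 => by
      rw [h0] at hlt
      have := mul_nonneg (mul_nonneg (hm.1 (i, j)) (hs (i, j)).le)
        (mul_nonneg (hm.1 (i', j')) (hs (i', j')).le)
      simp only [zero_mul, mul_zero] at hlt; linarith
    -- Mass `ε` is moved along the cycle off the two positive corners. Optimality is exploited
    -- through tangents at the perturbed plan, because `m` may vanish at the other two corners,
    -- where the derivative of the entropy is `-∞`; then `ε → 0`.
    have hev : ∀ᶠ ε in 𝓝[>] (0 : ℝ), (m (i, j') - ε) * s (i, j') * ((m (i', j) - ε) * s (i', j)) ≤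
        (m (i, j) + ε) * s (i, j) * ((m (i', j') + ε) * s (i', j')) := by
      have hsmall : ∀ᶠ ε in 𝓝[>] (0 : ℝ), ε < min (m (i, j')) (m (i', j)) :=
        nhdsWithin_le_nhds (Iio_mem_nhds (lt_min hp2 hp3))
      filter_upwards [hsmall, self_mem_nhdsWithin] with ε hε hε0
      have hε0 : 0 < ε := hε0
      have hε2 : 0 < m (i, j') - ε := by have := min_le_left (m (i, j')) (m (i', j)); linarith
      have hε3 : 0 < m (i', j) - ε := by have := min_le_right (m (i, j')) (m (i', j)); linarith
      set C := rectCycle i i' j j' with hC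
      have hC1 : C (i, j) = 1 := by simp [hC, rectCycle, hii, hjj]
      have hC2 : C (i, j') = -1 := by simp [hC, rectCycle, hii, hjj.symm]
      have hC3 : C (i', j) = -1 := by simp [hC, rectCycle, hii.symm, hjj]
      have hC4 : C (i', j') = 1 := by simp [hC, rectCycle, hii.symm, hjj.symm]
      have hC0 : ∀ t, t ≠ (i, j) → t ≠ (i, j') → t ≠ (i', j) → t ≠ (i', j') → C t = 0 := by
        rintro ⟨e, g⟩ h1 h2 h3 h4
        simp only [hC, rectCycle]
        by_cases e1 : e = i <;> by_cases e2 : e = i' <;> by_cases e3 : g = j <;>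
          by_cases e4 : g = j' <;> simp_all
      have hcell : ∀ t, (0 < m t + ε * C t ∧ C t ≠ 0) ∨ C t = 0 := by
        intro t
        by_cases h1 : t = (i, j)
        · left; subst h1; rw [hC1]; have := hm.1 (i, j); constructor <;> [linarith; norm_num]
        by_cases h2 : t = (i, j')
        · left; subst h2; rw [hC2]; constructor <;> [linarith; norm_num]
        by_cases h3 : t = (i', j)
        · left; subst h3; rw [hC3]; constructor <;> [linarith; norm_num]
        by_cases h4 : t = (i', j')
        · left; subst h4; rw [hC4]; have := hm.1 (i', j'); constructor <;> [linarith; norm_num]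
        exact Or.inr (hC0 t h1 h2 h3 h4)
      have hmem : (fun t => m t + ε * C t) ∈ transportPolytope a b := by
        refine ⟨fun t => ?_, fun c => ?_, fun e => ?_⟩
        · rcases hcell t with h | h
          · exact h.1.le
          · simpa [h] using hm.1 t
        · simp only [Finset.sum_add_distrib, hm.2.1 c, ← Finset.mul_sum, hC, sum_rectCycle_row]
          simp
        · simp only [Finset.sum_add_distrib, hm.2.2 e, ← Finset.mul_sum, hC, sum_rectCycle_col]
          simp
      have h1 := hmin hmem
      have h2 : ∑ t, ((m t + ε * C t) * Real.log ((m t + ε * C t) * s t) -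
          ε * (C t * (Real.log ((m t + ε * C t) * s t) + 1))) ≤
          ∑ t, m t * Real.log (m t * s t) := by
        refine Finset.sum_le_sum fun t _ => ?_
        rcases hcell t with h | h
        · have := mul_log_tangent_le h.1 (hm.1 t) (hs t)
          linarith
        · simp [h]
      have h3 : Φ m ≤ Φ (fun t => m t + ε * C t) := h1
      -- The constant `1` in the derivative drops out, since the coefficients of the cycle sum to
      -- zero.
      rw [Finset.sum_sub_distrib, ← Finset.mul_sum, hC, sum_mul_rectCycle, ← hC] at h2
      simp only [hC1, hC2, hC3, hC4] at h2
      have h4 : 0 ≤ Real.log ((m (i, j) + ε * 1) * s (i, j)) +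
          Real.log ((m (i', j') + ε * 1) * s (i', j')) -
          (Real.log ((m (i, j') + ε * -1) * s (i, j')) +
          Real.log ((m (i', j) + ε * -1) * s (i', j))) := by
        simp only [hΦ] at h3
        by_contra! hneg
        nlinarith
      have hp1 : 0 < m (i, j) + ε := by have := hm.1 (i, j); linarith
      have hp4 : 0 < m (i', j') + ε := by have := hm.1 (i', j'); linarith
      have q1 := mul_pos hp1 (hs (i, j))
      have q2 := mul_pos hε2 (hs (i, j'))
      have q3 := mul_pos hε3 (hs (i', j))
      have q4 := mul_pos hp4 (hs (i', j'))
      simp only [mul_one, mul_neg, ← sub_eq_add_neg] at h4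
      rw [← Real.log_mul q1.ne' q4.ne', ← Real.log_mul q2.ne' q3.ne', sub_nonneg] at h4
      exact (Real.log_le_log_iff (by positivity) (by positivity)).1 h4
    have hl : Tendsto (fun ε : ℝ => (m (i, j') - ε) * s (i, j') * ((m (i', j) - ε) * s (i', j)))
        (𝓝[>] 0) (𝓝 (m (i, j') * s (i, j') * (m (i', j) * s (i', j)))) := by
      have : Continuous
          (fun ε : ℝ => (m (i, j') - ε) * s (i, j') * ((m (i', j) - ε) * s (i', j))) := by fun_prop
      simpa using (this.tendsto 0).mono_left nhdsWithin_le_nhds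
    have hr : Tendsto (fun ε : ℝ => (m (i, j) + ε) * s (i, j) * ((m (i', j') + ε) * s (i', j')))
        (𝓝[>] 0) (𝓝 (m (i, j) * s (i, j) * (m (i', j') * s (i', j')))) := by
      have : Continuous
          (fun ε : ℝ => (m (i, j) + ε) * s (i, j) * ((m (i', j') + ε) * s (i', j'))) := by fun_prop
      simpa using (this.tendsto 0).mono_left nhdsWithin_le_nhds
    exact absurd (le_of_tendsto_of_tendsto hl hr hev) (not_le.2 hlt)
  refine ⟨m, hm, fun i i' j j' => ?_⟩
  by_cases hii : i = i'
  · subst hii; ring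
  by_cases hjj : j = j'
  · subst hjj; ring
  -- Exchanging the two columns reverses the inequality.
  exact le_antisymm (key i i' j' j hii (Ne.symm hjj)) (key i i' j j' hii hjj)

end Finite

/-! ### Schrödinger plans as limits of finite plans -/

section Approximation

variable {X Z : Type*} [MeasurableSpace X] [MeasurableSpace Z]

/-- Discretization of `Q`: the weights of these atoms are the row or column sums of a finite system.
-/
theorem map_simpleFunc_eq_sum [MeasurableSingletonClass X] (Q : Measure X)
    (T : SimpleFunc X X) :
    Q.map T = ∑ i : T.range, Q (T ⁻¹' {(i : X)}) • Measure.dirac (i : X) := by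
  ext A hA
  have h1 : Q.map T A = ∫⁻ x, A.indicator (fun _ => (1 : ℝ≥0∞)) (T x) ∂Q := by
    rw [← lintegral_map (f := A.indicator fun _ => (1 : ℝ≥0∞))
      (measurable_const.indicator hA) T.measurable]
    simp [lintegral_indicator hA]
  have h2 := SimpleFunc.map_lintegral (μ := Q) (A.indicator fun _ => (1 : ℝ≥0∞)) T
  rw [← SimpleFunc.lintegral_eq_lintegral] at h2
  simp only [SimpleFunc.map_apply] at h2
  rw [h1, h2, Measure.finsetSum_apply, ← Finset.sum_coe_sort]
  refine Finset.sum_congr rfl fun i _ => ?_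
  rw [Measure.smul_apply, Measure.dirac_apply' _ hA, smul_eq_mul, mul_comm]
  rfl

theorem sum_measure_fiber_simpleFunc [MeasurableSingletonClass X] (Q : Measure X)
    [IsProbabilityMeasure Q] (T : SimpleFunc X X) :
    ∑ i : T.range, (Q (T ⁻¹' {(i : X)})).toReal = 1 := by
  have h := congrArg (fun M : Measure X => M Set.univ) (map_simpleFunc_eq_sum Q T)
  simp only [Measure.finsetSum_apply, Measure.smul_apply, measure_univ, smul_eq_mul,
    mul_one, Measure.map_apply T.measurable MeasurableSet.univ, Set.preimage_univ] at h
  rw [← ENNReal.toReal_sum (fun i _ => measure_ne_top _ _), ← h]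
  simp

/-- A finite Schrödinger plan between the images of `Q` and `N` under simple functions. -/
theorem exists_finite_plan [MeasurableSingletonClass X] [MeasurableSingletonClass Z]
    (Q : Measure X) [IsProbabilityMeasure Q] (N : Measure Z) [IsProbabilityMeasure N]
    (T : SimpleFunc X X) (S : SimpleFunc Z Z) {s : X × Z → ℝ} (hs : ∀ t, 0 < s t) :
    ∃ P : Measure (X × Z), IsProbabilityMeasure P ∧ P.fst = Q.map T ∧ P.snd = N.map S ∧
      ∀ (f : X → ℝ) (g : Z → ℝ),
        (∫ t, f t.1 * g t.2 * s t ∂P) * (∫ t, s t ∂P) =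
          (∫ t, f t.1 * s t ∂P) * (∫ t, g t.2 * s t ∂P) := by
  obtain ⟨m, ⟨hm0, hm1, hm2⟩, hcr⟩ := exists_mem_transportPolytope_crossRatio
    (a := fun i : T.range => (Q (T ⁻¹' {(i : X)})).toReal)
    (b := fun j : S.range => (N (S ⁻¹' {(j : Z)})).toReal)
    (fun _ => ENNReal.toReal_nonneg) (fun _ => ENNReal.toReal_nonneg) (sum_measure_fiber_simpleFunc Q T)
    (sum_measure_fiber_simpleFunc N S)
    (s := fun t => s (t.1, t.2)) (fun _ => hs _)
  let P : Measure (X × Z) :=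
    ∑ t : T.range × S.range, ENNReal.ofReal (m t) • Measure.dirac ((t.1 : X), (t.2 : Z))
  have hfst : P.fst = Q.map T := by
    ext A hA
    rw [map_simpleFunc_eq_sum, Measure.fst_apply hA]
    simp only [P, Measure.finsetSum_apply, Measure.smul_apply, smul_eq_mul,
      Fintype.sum_prod_type, Measure.dirac_apply' _ (measurable_fst hA),
      Measure.dirac_apply' _ hA]
    refine Finset.sum_congr rfl fun i _ => ?_
    have h1 : ∀ j : S.range, (Prod.fst ⁻¹' A).indicator (1 : X × Z → ℝ≥0∞) ((i : X), (j : Z)) =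
        A.indicator 1 (i : X) := fun j => rfl
    simp only [h1]
    rw [← Finset.sum_mul, ← ENNReal.ofReal_sum_of_nonneg (fun j _ => hm0 _), hm1,
      ENNReal.ofReal_toReal (measure_ne_top _ _)]
  have hsnd : P.snd = N.map S := by
    ext A hA
    rw [map_simpleFunc_eq_sum, Measure.snd_apply hA]
    simp only [P, Measure.finsetSum_apply, Measure.smul_apply, smul_eq_mul,
      Fintype.sum_prod_type_right, Measure.dirac_apply' _ (measurable_snd hA),
      Measure.dirac_apply' _ hA]
    refine Finset.sum_congr rfl fun j _ => ?_
    have h1 : ∀ i : T.range, (Prod.snd ⁻¹' A).indicator (1 : X × Z → ℝ≥0∞) ((i : X), (j : Z)) =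
        A.indicator 1 (j : Z) := fun i => rfl
    simp only [h1]
    rw [← Finset.sum_mul, ← ENNReal.ofReal_sum_of_nonneg (fun i _ => hm0 _), hm2,
      ENNReal.ofReal_toReal (measure_ne_top _ _)]
  have hint : ∀ F : X × Z → ℝ, ∫ t, F t ∂P = ∑ i : T.range, ∑ j : S.range, m (i, j) * F (i, j) := by
    intro F
    rw [integral_finsetSum_measure]
    · rw [Fintype.sum_prod_type]
      refine Finset.sum_congr rfl fun i _ => Finset.sum_congr rfl fun j _ => ?_
      rw [integral_smul_measure, integral_dirac, ENNReal.toReal_ofReal (hm0 _), smul_eq_mul]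
    · intro t _
      exact (integrable_dirac (by simp)).smul_measure (by simp)
  refine ⟨P, ⟨?_⟩, hfst, hsnd, fun f g => ?_⟩
  · rw [← Measure.fst_univ, hfst, Measure.map_apply T.measurable MeasurableSet.univ]; simp
  · simp only [hint]
    simp only [Finset.sum_mul_sum]
    refine Finset.sum_congr rfl fun i _ => Finset.sum_congr rfl fun i' _ => ?_
    -- Exchanging the column sums on one side matches the two diagonals of each rectangle, so the
    -- cross ratios give the identity term by term.
    rw [Finset.sum_comm]
    refine Finset.sum_congr rfl fun j _ => Finset.sum_congr rfl fun j' _ => ?_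
    have := hcr i i' j' j
    linear_combination f i * g j' * this

/-- Dominated convergence with the constant bound `‖f‖`; it serves for both discretized marginals.
-/
theorem tendsto_map_of_forall_tendsto [TopologicalSpace X] [OpensMeasurableSpace X]
    (Q : ProbabilityMeasure X) {T : ℕ → X → X} (hT : ∀ n, Measurable (T n))
    (hlim : ∀ x, Tendsto (fun n => T n x) atTop (𝓝 x)) :
    Tendsto (fun n => Q.map (hT n).aemeasurable) atTop (𝓝 Q) := by
  rw [ProbabilityMeasure.tendsto_iff_forall_integral_tendsto]
  intro f
  have h1 : ∀ n, ∫ x, f x ∂(Q.map (hT n).aemeasurable : Measure X) = ∫ x, f (T n x) ∂(Q : Measure X) := by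
    intro n
    rw [ProbabilityMeasure.toMeasure_map, integral_map (hT n).aemeasurable
      f.continuous.measurable.aestronglyMeasurable]
  simp only [h1]
  refine tendsto_integral_of_dominated_convergence (fun _ => ‖f‖)
    (fun n => (f.continuous.measurable.comp (hT n)).aestronglyMeasurable) (integrable_const _)
    (fun n => .of_forall fun x => f.norm_coe_le_norm _)
    (.of_forall fun x => (f.continuous.tendsto x).comp (hlim x))

/-- A coupling of `Q` and `N` whose product with the weight `s` satisfies the cross ratio identity,
tested against products of bounded continuous functions. -/
theorem exists_plan_crossRatio [PseudoMetricSpace X] [CompleteSpace X]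
    [SecondCountableTopology X] [BorelSpace X] [T2Space X]
    [PseudoMetricSpace Z] [CompleteSpace Z]
    [SecondCountableTopology Z] [BorelSpace Z] [T2Space Z]
    (Q : Measure X) [IsProbabilityMeasure Q] (N : Measure Z) [IsProbabilityMeasure N]
    (s : X × Z →ᵇ ℝ) (hs : ∀ t, 0 < s t) :
    ∃ P : Measure (X × Z), IsProbabilityMeasure P ∧ P.fst = Q ∧ P.snd = N ∧
      ∀ (f : X →ᵇ ℝ) (g : Z →ᵇ ℝ),
        (∫ t, f t.1 * g t.2 * s t ∂P) * (∫ t, s t ∂P) =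
          (∫ t, f t.1 * s t ∂P) * (∫ t, g t.2 * s t ∂P) := by
  obtain ⟨x₀⟩ : Nonempty X := Q.nonempty_of_neZero
  obtain ⟨z₀⟩ : Nonempty Z := N.nonempty_of_neZero
  let T : ℕ → SimpleFunc X X := SimpleFunc.approxOn id measurable_id Set.univ x₀ (Set.mem_univ _)
  let S : ℕ → SimpleFunc Z Z := SimpleFunc.approxOn id measurable_id Set.univ z₀ (Set.mem_univ _)
  choose P hP hfst hsnd hcr using fun n => exists_finite_plan Q N (T n) (S n) hs
  let Q' : ProbabilityMeasure X := ⟨Q, inferInstance⟩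
  let N' : ProbabilityMeasure Z := ⟨N, inferInstance⟩
  let P' : ℕ → ProbabilityMeasure (X × Z) := fun n => ⟨P n, hP n⟩
  have hTlim := tendsto_map_of_forall_tendsto Q' (fun n => (T n).measurable)
    (fun x => SimpleFunc.tendsto_approxOn measurable_id (Set.mem_univ x₀) (by simp))
  have hSlim := tendsto_map_of_forall_tendsto N' (fun n => (S n).measurable)
    (fun x => SimpleFunc.tendsto_approxOn measurable_id (Set.mem_univ z₀) (by simp))
  have hfst' : ∀ n, (P' n).map measurable_fst.aemeasurable =
      Q'.map (T n).measurable.aemeasurable := fun n => Subtype.ext (hfst n)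
  have hsnd' : ∀ n, (P' n).map measurable_snd.aemeasurable =
      N'.map (S n).measurable.aemeasurable := fun n => Subtype.ext (hsnd n)
  -- The discretized marginals converge, hence are relatively compact and tight; tight marginals
  -- make the plans tight.
  have htX := isTightMeasureSet_of_isCompact_closure
    (hTlim.isCompact_insert_range.closure_of_subset (Set.subset_insert _ _))
  have htZ := isTightMeasureSet_of_isCompact_closure
    (hSlim.isCompact_insert_range.closure_of_subset (Set.subset_insert _ _))
  have htight : IsTightMeasureSet
      {((μ : ProbabilityMeasure (X × Z)) : Measure (X × Z)) | μ ∈ Set.range P'} := by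
    refine IsTightMeasureSet.prodMk (htX.subset ?_) (htZ.subset ?_)
    · rintro _ ⟨_, ⟨_, ⟨n, rfl⟩, rfl⟩, rfl⟩
      exact ⟨_, ⟨n, rfl⟩, (hfst n).symm⟩
    · rintro _ ⟨_, ⟨_, ⟨n, rfl⟩, rfl⟩, rfl⟩
      exact ⟨_, ⟨n, rfl⟩, (hsnd n).symm⟩
  have hcomp := isCompact_closure_of_isTightMeasureSet htight
  obtain ⟨R, -, φ, hφ, hR⟩ :=
    hcomp.tendsto_subseq (fun n => subset_closure (Set.mem_range_self (f := P') n))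
  have hint := ProbabilityMeasure.tendsto_iff_forall_integral_tendsto.1 hR
  refine ⟨R, inferInstance, ?_, ?_, fun f g => ?_⟩
  · have h1 := ((ProbabilityMeasure.continuous_map (Ω := X × Z) continuous_fst).tendsto R).comp hR
    have h2 := hTlim.comp hφ.tendsto_atTop
    have h3 := tendsto_nhds_unique (h1.congr fun n => hfst' (φ n)) h2
    exact congrArg Subtype.val h3
  · have h1 := ((ProbabilityMeasure.continuous_map (Ω := X × Z) continuous_snd).tendsto R).comp hR
    have h2 := hSlim.comp hφ.tendsto_atTop
    have h3 := tendsto_nhds_unique (h1.congr fun n => hsnd' (φ n)) h2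
    exact congrArg Subtype.val h3
  · let f' : X × Z →ᵇ ℝ := f.compContinuous ⟨Prod.fst, continuous_fst⟩
    let g' : X × Z →ᵇ ℝ := g.compContinuous ⟨Prod.snd, continuous_snd⟩
    -- All four integrands are bounded and continuous, so both sides pass to the weak limit.
    have h1 := (hint (f' * g' * s)).mul (hint s)
    have h2 := (hint (f' * s)).mul (hint (g' * s))
    exact tendsto_nhds_unique (h1.congr fun n => hcr (φ n) f g) h2

/-- A coupling of `Q` and `N` that becomes a product measure when multiplied by the weight `s`. -/
theorem exists_plan_withDensity_eq_prod [PseudoMetricSpace X] [CompleteSpace X]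
    [SecondCountableTopology X] [BorelSpace X] [T2Space X]
    [PseudoMetricSpace Z] [CompleteSpace Z]
    [SecondCountableTopology Z] [BorelSpace Z] [T2Space Z]
    (Q : Measure X) [IsProbabilityMeasure Q] (N : Measure Z) [IsProbabilityMeasure N]
    (s : X × Z →ᵇ ℝ) (hs : ∀ t, 0 < s t) :
    ∃ (P : Measure (X × Z)) (α : Measure X) (β : Measure Z), IsProbabilityMeasure P ∧
      IsFiniteMeasure α ∧ IsFiniteMeasure β ∧ P.fst = Q ∧ P.snd = N ∧
      P.withDensity (fun t => ENNReal.ofReal (s t)) = α.prod β := by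
  obtain ⟨P, hP, hfst, hsnd, hcr⟩ := exists_plan_crossRatio Q N s hs
  set σ := P.withDensity (fun t => ENNReal.ofReal (s t)) with hσ
  have hmeas : Measurable fun t => ENNReal.ofReal (s t) :=
    ENNReal.measurable_ofReal.comp s.continuous.measurable
  have hsi : Integrable s P := s.integrable P
  have hfin : IsFiniteMeasure σ := isFiniteMeasure_withDensity_ofReal hsi.hasFiniteIntegral
  have hint : ∀ F : X × Z → ℝ, ∫ t, F t ∂σ = ∫ t, F t * s t ∂P := by
    intro F
    rw [hσ, integral_withDensity_eq_integral_toReal_smul hmeas (by simp)]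
    simp only [ENNReal.toReal_ofReal (hs _).le, smul_eq_mul, mul_comm]
  have hc : σ.real Set.univ = ∫ t, s t ∂P := by
    have := hint (fun _ => 1)
    simpa using this
  have hpos : 0 < ∫ t, s t ∂P := by
    rw [integral_pos_iff_support_of_nonneg (fun t => (hs t).le) hsi]
    have : Function.support s = Set.univ := Set.eq_univ_of_forall fun t => (hs t).ne'
    rw [this]; simp
  have hβ : IsFiniteMeasure ((σ Set.univ)⁻¹ • σ.snd) := by
    refine Measure.smul_finite _ (ENNReal.inv_ne_top.2 fun h0 => ?_)
    simp only [Measure.real, h0, ENNReal.toReal_zero] at hc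
    exact hpos.ne hc
  -- A product measure is the product of its marginals divided by its total mass; the normalization
  -- is put on the second factor.
  refine ⟨P, σ.fst, (σ Set.univ)⁻¹ • σ.snd, hP, inferInstance, hβ, hfst, hsnd, ?_⟩
  refine Measure.eq_prod_of_integral_mul_boundedContinuousFunction fun f g => ?_
  rw [integral_smul_measure, Measure.fst, Measure.snd,
    integral_map measurable_fst.aemeasurable f.continuous.measurable.aestronglyMeasurable,
    integral_map measurable_snd.aemeasurable g.continuous.measurable.aestronglyMeasurable,
    ENNReal.toReal_inv, ← Measure.real, hc, hint, hint, hint, smul_eq_mul]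
  have := hcr f g
  field_simp
  linarith

end Approximation

/-! ### Existence for the Schrödinger system -/

section Existence

variable {X Z : Type*}

/-- A positive continuous function on a product of proper normed groups has a positive continuous
minorant of product form. -/
theorem exists_continuous_mul_le [NormedAddCommGroup X] [ProperSpace X] [NormedAddCommGroup Z]
    [ProperSpace Z] {q : X × Z → ℝ} (hq : Continuous q) (hpos : ∀ t, 0 < q t) :
    ∃ (u : X → ℝ) (v : Z → ℝ), Continuous u ∧ Continuous v ∧ (∀ x, 0 < u x) ∧ (∀ z, 0 < v z) ∧
      ∀ x z, u x * v z ≤ q (x, z) := by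
  -- The admissible lower bounds, at most `1`, for `q` on a product of balls of radius `r` form a
  -- convex set. A continuous selection `w` yields `u = w ‖x‖`, `v = w ‖z‖`: the factor with the
  -- larger radius bounds `q`, the other is at most `1`.
  let t : ℝ → Set ℝ := fun r =>
    {c | 0 < c ∧ c ≤ 1 ∧ ∀ x z, ‖x‖ ≤ r → ‖z‖ ≤ r → c ≤ q (x, z)}
  have hconv : ∀ r, Convex ℝ (t r) := by
    rintro r a ⟨ha0, ha1, ha⟩ b ⟨hb0, hb1, hb⟩ θ η hθ hη hsum
    simp only [smul_eq_mul]
    refine ⟨?_, ?_, fun x z hx hz => ?_⟩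
    · rcases hθ.eq_or_lt with rfl | hθ'
      · have : η = 1 := by linarith
        subst this; simpa using hb0
      · positivity
    · nlinarith
    · have h1 := mul_le_mul_of_nonneg_left (ha x z hx hz) hθ
      have h2 := mul_le_mul_of_nonneg_left (hb x z hx hz) hη
      have h3 : q (x, z) = θ * q (x, z) + η * q (x, z) := by rw [← add_mul, hsum, one_mul]
      linarith
  obtain ⟨w, hw⟩ := exists_continuous_forall_mem_convex_of_local_const hconv fun r => by
    have hK : IsCompact (Metric.closedBall (0 : X) (r + 1) ×ˢ Metric.closedBall (0 : Z) (r + 1)) :=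
      (isCompact_closedBall _ _).prod (isCompact_closedBall _ _)
    obtain ⟨c, hc0, hc⟩ := hK.exists_forall_le' hq.continuousOn (a := 0) (fun t _ => hpos t)
    refine ⟨min c 1, ?_⟩
    filter_upwards [Iio_mem_nhds (lt_add_one r)] with r' hr'
    have hr' : r' < r + 1 := hr'
    refine ⟨lt_min hc0 one_pos, min_le_right _ _, fun x z hx hz => (min_le_left _ _).trans ?_⟩
    refine hc (x, z) ⟨?_, ?_⟩
    · simpa using hx.trans hr'.le
    · simpa using hz.trans hr'.le
  refine ⟨fun x => w ‖x‖, fun z => w ‖z‖, by fun_prop, by fun_prop, fun x => (hw _).1,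
    fun z => (hw _).1, fun x z => ?_⟩
  rcases le_total ‖x‖ ‖z‖ with h | h
  · calc w ‖x‖ * w ‖z‖ ≤ 1 * w ‖z‖ := mul_le_mul_of_nonneg_right (hw _).2.1 (hw _).1.le
      _ ≤ q (x, z) := by rw [one_mul]; exact (hw _).2.2 x z h le_rfl
  · calc w ‖x‖ * w ‖z‖ ≤ w ‖x‖ * 1 := mul_le_mul_of_nonneg_left (hw _).2.1 (hw _).1.le
      _ ≤ q (x, z) := by rw [mul_one]; exact (hw _).2.2 x z le_rfl h

variable [MeasurableSpace X] [MeasurableSpace Z]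

theorem lintegral_ne_zero_of_forall_ne_zero {μ : Measure X} (hμ : μ ≠ 0) {F : X → ℝ≥0∞}
    (hF : Measurable F) (hF0 : ∀ x, F x ≠ 0) : ∫⁻ x, F x ∂μ ≠ 0 := fun h0 => by
  rw [lintegral_eq_zero_iff hF] at h0
  exact hμ (ae_eq_bot.1 (Filter.eventually_false_iff_eq_bot.1 (h0.mono fun x hx => hF0 x hx)))

theorem fst_prod_withDensity (α : Measure X) (β : Measure Z) [SFinite α] [SFinite β]
    {K : X × Z → ℝ≥0∞} (hK : Measurable K) :
    ((α.prod β).withDensity K).fst = α.withDensity (fun x => ∫⁻ z, K (x, z) ∂β) := by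
  ext A hA
  rw [Measure.fst_apply hA, withDensity_apply _ (measurable_fst hA), withDensity_apply _ hA,
    show Prod.fst ⁻¹' A = A ×ˢ (Set.univ : Set Z) by ext; simp, ← Measure.prod_restrict,
    lintegral_prod _ hK.aemeasurable]
  simp

theorem snd_prod_withDensity (α : Measure X) (β : Measure Z) [SFinite α] [SFinite β]
    {K : X × Z → ℝ≥0∞} (hK : Measurable K) :
    ((α.prod β).withDensity K).snd = β.withDensity (fun z => ∫⁻ x, K (x, z) ∂α) := by
  ext A hA
  rw [Measure.snd_apply hA, withDensity_apply _ (measurable_snd hA), withDensity_apply _ hA,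
    show Prod.snd ⁻¹' A = (Set.univ : Set X) ×ˢ A by ext; simp, ← Measure.prod_restrict,
    lintegral_prod_symm _ hK.aemeasurable]
  simp

/-- Existence of a plan of the form `q(x, z) α(dx) β(dz)` with prescribed marginals. -/
theorem exists_plan_eq_prod_withDensity [NormedAddCommGroup X] [ProperSpace X] [BorelSpace X]
    [NormedAddCommGroup Z] [ProperSpace Z] [BorelSpace Z]
    (Q : Measure X) [IsProbabilityMeasure Q] (N : Measure Z) [IsProbabilityMeasure N]
    {q : X × Z → ℝ} (hq : Continuous q) (hpos : ∀ t, 0 < q t) :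
    ∃ (α : Measure X) (β : Measure Z), SigmaFinite α ∧ SigmaFinite β ∧
      ((α.prod β).withDensity (fun t => ENNReal.ofReal (q t))).fst = Q ∧
      ((α.prod β).withDensity (fun t => ENNReal.ofReal (q t))).snd = N := by
  obtain ⟨u, v, hu, hv, hu0, hv0, huv⟩ := exists_continuous_mul_le hq hpos
  -- The weight `1 / q` may be unbounded; multiplied by the minorant it takes values in `(0, 1]`.
  have hscont : Continuous (fun t : X × Z => u t.1 * v t.2 / q t) :=
    Continuous.div₀ (by fun_prop) hq fun t => (hpos t).ne'
  have hs0 : ∀ t : X × Z, 0 < u t.1 * v t.2 / q t := fun t =>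
    div_pos (mul_pos (hu0 _) (hv0 _)) (hpos t)
  let s : X × Z →ᵇ ℝ := BoundedContinuousFunction.ofNormedAddCommGroup
    (fun t : X × Z => u t.1 * v t.2 / q t) hscont 1 (fun t => by
      rw [Real.norm_of_nonneg (hs0 t).le]
      exact (div_le_one (hpos t)).2 (huv t.1 t.2))
  obtain ⟨P, α, β, hP, hα, hβ, hfst, hsnd, hprod⟩ :=
    exists_plan_withDensity_eq_prod Q N s (fun t => hs0 t)
  have hsm : Measurable fun t => ENNReal.ofReal (s t) :=
    ENNReal.measurable_ofReal.comp s.continuous.measurable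
  have hum : Measurable fun x => ENNReal.ofReal (u x)⁻¹ :=
    ENNReal.measurable_ofReal.comp hu.measurable.inv
  have hvm : Measurable fun z => ENNReal.ofReal (v z)⁻¹ :=
    ENNReal.measurable_ofReal.comp hv.measurable.inv
  have huvm : Measurable fun t : X × Z => ENNReal.ofReal (u t.1)⁻¹ * ENNReal.ofReal (v t.2)⁻¹ :=
    (hum.comp measurable_fst).mul (hvm.comp measurable_snd)
  have hqm : Measurable fun t => ENNReal.ofReal (q t) :=
    ENNReal.measurable_ofReal.comp hq.measurable
  have hα' : SigmaFinite (α.withDensity fun x => ENNReal.ofReal (u x)⁻¹) :=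
    SigmaFinite.withDensity_ofReal _
  have hβ' : SigmaFinite (β.withDensity fun z => ENNReal.ofReal (v z)⁻¹) :=
    SigmaFinite.withDensity_ofReal _
  -- The factors `u`, `v` are absorbed into the two measures, which remain σ-finite.
  have hPeq : P = (((α.withDensity fun x => ENNReal.ofReal (u x)⁻¹).prod
      (β.withDensity fun z => ENNReal.ofReal (v z)⁻¹)).withDensity
        (fun t => ENNReal.ofReal (q t))) := by
    rw [prod_withDensity hum hvm, ← hprod,
      ← withDensity_mul _ hsm huvm, ← withDensity_mul _ (hsm.mul huvm) hqm]
    conv_lhs => rw [← withDensity_one (μ := P)]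
    congr 1
    funext t
    simp only [Pi.mul_apply, Pi.one_apply, show s t = u t.1 * v t.2 / q t from rfl]
    rw [← ENNReal.ofReal_mul (inv_nonneg.2 (hu0 _).le), ← ENNReal.ofReal_mul (hs0 t).le,
      ← ENNReal.ofReal_mul (mul_nonneg (hs0 t).le
        (mul_nonneg (inv_nonneg.2 (hu0 _).le) (inv_nonneg.2 (hv0 _).le)))]
    have h1 : u t.1 * v t.2 / q t * ((u t.1)⁻¹ * (v t.2)⁻¹) * q t = 1 := by
      have := (hu0 t.1).ne'
      have := (hv0 t.2).ne'
      have := (hpos t).ne'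
      field_simp
    rw [h1, ENNReal.ofReal_one]
  exact ⟨_, _, hα', hβ', hPeq ▸ hfst, hPeq ▸ hsnd⟩

/-- Existence for the Schrödinger equation with marginals `Q` and `N ≪ ℓ`. -/
theorem exists_schrodinger_solution [NormedAddCommGroup X] [ProperSpace X] [BorelSpace X]
    [NormedAddCommGroup Z] [ProperSpace Z] [BorelSpace Z] (ℓ : Measure Z) [SigmaFinite ℓ]
    (Q : Measure X) [IsProbabilityMeasure Q] (N : Measure Z) [IsProbabilityMeasure N]
    (hN : N ≪ ℓ) {q : X × Z → ℝ} (hq : Continuous q) (hpos : ∀ t, 0 < q t) :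
    ∃ g : Z → ℝ≥0, Measurable g ∧ N = ℓ.withDensity (fun z => (g z : ℝ≥0∞) *
      ∫⁻ x, ENNReal.ofReal (q (x, z)) /
        (∫⁻ z', (g z' : ℝ≥0∞) * ENNReal.ofReal (q (x, z')) ∂ℓ) ∂Q) := by
  obtain ⟨α, β, hα, hβ, hfst, hsnd⟩ := exists_plan_eq_prod_withDensity Q N hq hpos
  set K : X × Z → ℝ≥0∞ := fun t => ENNReal.ofReal (q t) with hKdef
  have hKm : Measurable K := ENNReal.measurable_ofReal.comp hq.measurable
  have hKz : ∀ x, Measurable fun z => K (x, z) := fun x => hKm.comp measurable_prodMk_left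
  have hKx : ∀ z, Measurable fun x => K (x, z) := fun z => hKm.comp measurable_prodMk_right
  have hK0 : ∀ t, K t ≠ 0 := fun t => (ENNReal.ofReal_pos.2 (hpos t)).ne'
  rw [fst_prod_withDensity α β hKm] at hfst
  rw [snd_prod_withDensity α β hKm] at hsnd
  have hα0 : α ≠ 0 := by
    rintro rfl
    have h := congrArg (fun M : Measure X => M Set.univ) hfst
    simp at h
  have hβ0 : β ≠ 0 := by
    rintro rfl
    have h := congrArg (fun M : Measure Z => M Set.univ) hsnd
    simp at h
  have hφm : Measurable fun x => ∫⁻ z, K (x, z) ∂β := hKm.lintegral_prod_right'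
  have hφm' : Measurable fun x => (∫⁻ z, K (x, z) ∂β)⁻¹ := hφm.inv
  have hχm : Measurable fun z => ∫⁻ x, K (x, z) ∂α := hKm.lintegral_prod_left'
  have hφ0 : ∀ x, ∫⁻ z, K (x, z) ∂β ≠ 0 := fun x =>
    lintegral_ne_zero_of_forall_ne_zero hβ0 (hKz x) fun z => hK0 (x, z)
  have hχ0 : ∀ z, ∫⁻ x, K (x, z) ∂α ≠ 0 := fun z =>
    lintegral_ne_zero_of_forall_ne_zero hα0 (hKx z) fun x => hK0 (x, z)
  have hφtop : ∀ᵐ x ∂α, ∫⁻ z, K (x, z) ∂β ≠ ∞ := by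
    refine (ae_lt_top hφm ?_).mono fun x hx => hx.ne
    have h := congrArg (fun M : Measure X => M Set.univ) hfst
    simp only [withDensity_apply _ MeasurableSet.univ, Measure.restrict_univ, measure_univ] at h
    rw [h]; simp
  -- `N` has a nowhere vanishing density with respect to `β`, so `β ≪ N ≪ ℓ`.
  have hβℓ : β ≪ ℓ :=
    (hsnd ▸ withDensity_absolutelyContinuous' hχm.aemeasurable (.of_forall hχ0)).trans hN
  let g : Z → ℝ≥0 := fun z => (β.rnDeriv ℓ z).toNNReal
  have hgm : Measurable g := (Measure.measurable_rnDeriv β ℓ).ennreal_toNNReal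
  have hβeq : β = ℓ.withDensity (fun z => (g z : ℝ≥0∞)) := by
    conv_lhs => rw [← Measure.withDensity_rnDeriv_eq β ℓ hβℓ]
    refine withDensity_congr_ae ?_
    filter_upwards [Measure.rnDeriv_lt_top β ℓ] with z hz
    exact (ENNReal.coe_toNNReal hz.ne).symm
  have hφeq : ∀ x, ∫⁻ z, (g z : ℝ≥0∞) * K (x, z) ∂ℓ = ∫⁻ z, K (x, z) ∂β := by
    intro x
    conv_rhs => rw [hβeq]
    rw [lintegral_withDensity_eq_lintegral_mul _ hgm.coe_nnreal_ennreal (hKz x)]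
    rfl
  -- The first marginal condition, solved for `α`; its denominator is the potential of `g`.
  have hαeq : α = Q.withDensity (fun x => (∫⁻ z, K (x, z) ∂β)⁻¹) := by
    rw [← hfst]
    exact (withDensity_inv_same₀ hφm.aemeasurable (.of_forall hφ0) hφtop).symm
  refine ⟨g, hgm, ?_⟩
  have h1 : ∀ z, ∫⁻ x, K (x, z) / (∫⁻ z', (g z' : ℝ≥0∞) * K (x, z') ∂ℓ) ∂Q =
      ∫⁻ x, K (x, z) ∂α := by
    intro z
    conv_rhs => rw [hαeq]
    rw [lintegral_withDensity_eq_lintegral_mul _ hφm' (hKx z)]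
    simp only [hφeq, Pi.mul_apply, ENNReal.div_eq_inv_mul]
  change N = ℓ.withDensity (fun z => (g z : ℝ≥0∞) *
    ∫⁻ x, K (x, z) / (∫⁻ z', (g z' : ℝ≥0∞) * K (x, z') ∂ℓ) ∂Q)
  simp only [h1]
  conv_lhs => rw [← hsnd, hβeq, ← withDensity_mul _ hgm.coe_nnreal_ennreal hχm]
  rfl

end Existence

/-! ### Solutions of the Schrödinger equation -/

section Solutions

variable {X Z : Type*} [MeasurableSpace X] [MeasurableSpace Z]

/-- `g` solves the Schrödinger equation with kernel `K` and marginals `Q`, `N`. -/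
def IsSchrodinger (ℓ : Measure Z) (Q : Measure X) (N : Measure Z) (K : X × Z → ℝ≥0∞)
    (g : Z → ℝ≥0) : Prop :=
  Measurable g ∧ N = ℓ.withDensity (fun z => (g z : ℝ≥0∞) *
    ∫⁻ x, K (x, z) / (∫⁻ z', (g z' : ℝ≥0∞) * K (x, z') ∂ℓ) ∂Q)

/-- The denominator `x ↦ ∫ g(z) K(x, z) dz`. -/
def potential (ℓ : Measure Z) (K : X × Z → ℝ≥0∞) (g : Z → ℝ≥0) (x : X) : ℝ≥0∞ :=
  ∫⁻ z, (g z : ℝ≥0∞) * K (x, z) ∂ℓ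

/-- The plan `g(z) K(x, z) / (∫ g(z') K(x, z') dz') Q(dx) dz`. -/
def schrodingerPlan (ℓ : Measure Z) (Q : Measure X) (K : X × Z → ℝ≥0∞) (g : Z → ℝ≥0) :
    Measure (X × Z) :=
  (Q.prod ℓ).withDensity (fun t => (g t.2 : ℝ≥0∞) * K t / potential ℓ K g t.1)

variable {ℓ : Measure Z} {Q : Measure X} {N : Measure Z} {K : X × Z → ℝ≥0∞} {g g' : Z → ℝ≥0}


/-- The equation is homogeneous of degree zero in `g`: the outer factor `c` cancels the `c⁻¹` from
the denominator. -/
theorem IsSchrodinger.of_ae_eq_mul (h : IsSchrodinger ℓ Q N K g) (hg' : Measurable g') {c : ℝ≥0} (hc : 0 < c) (heq : g' =ᵐ[ℓ] fun z => c * g z) :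
    IsSchrodinger ℓ Q N K g' := by
  refine ⟨hg', ?_⟩
  have hc0 : (c : ℝ≥0∞) ≠ 0 := by simpa using hc.ne'
  have h1 : ∀ x, ∫⁻ z', (g' z' : ℝ≥0∞) * K (x, z') ∂ℓ =
      c * ∫⁻ z', (g z' : ℝ≥0∞) * K (x, z') ∂ℓ := by
    intro x
    rw [← lintegral_const_mul' _ _ ENNReal.coe_ne_top]
    refine lintegral_congr_ae ?_
    filter_upwards [heq] with z hz
    rw [hz, ENNReal.coe_mul, mul_assoc]
  rw [h.2]
  refine withDensity_congr_ae ?_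
  filter_upwards [heq] with z hz
  simp only [h1]
  have h2 : ∀ x, K (x, z) / (c * ∫⁻ z', (g z' : ℝ≥0∞) * K (x, z') ∂ℓ) =
      (c : ℝ≥0∞)⁻¹ * (K (x, z) / ∫⁻ z', (g z' : ℝ≥0∞) * K (x, z') ∂ℓ) := by
    intro x
    rw [div_eq_mul_inv, ENNReal.mul_inv (.inl hc0) (.inl ENNReal.coe_ne_top), div_eq_mul_inv]
    ring
  simp only [h2]
  rw [lintegral_const_mul' _ _ (ENNReal.inv_ne_top.2 hc0), hz, ENNReal.coe_mul, mul_comm (c : ℝ≥0∞),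
    mul_assoc, ← mul_assoc (c : ℝ≥0∞), ENNReal.mul_inv_cancel hc0 ENNReal.coe_ne_top, one_mul]

variable [SigmaFinite ℓ]

theorem measurable_potential (hK : Measurable K) (hg : Measurable g) :
    Measurable (potential ℓ K g) :=
  Measurable.lintegral_prod_right' (f := fun t : X × Z => (g t.2 : ℝ≥0∞) * K t)
    ((hg.comp measurable_snd).coe_nnreal_ennreal.mul hK)

theorem measurable_planDensity (hK : Measurable K) (hg : Measurable g) :
    Measurable fun t : X × Z => (g t.2 : ℝ≥0∞) * K t / potential ℓ K g t.1 :=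
  ((hg.comp measurable_snd).coe_nnreal_ennreal.mul hK).div
    ((measurable_potential hK hg).comp measurable_fst)

variable [IsProbabilityMeasure Q]

/-- The Schrödinger equation is precisely the second marginal condition. -/
theorem IsSchrodinger.snd_plan (hK : Measurable K) (h : IsSchrodinger ℓ Q N K g) :
    (schrodingerPlan ℓ Q K g).snd = N := by
  rw [schrodingerPlan, snd_prod_withDensity _ _ (measurable_planDensity hK h.1), h.2]
  congr 1
  funext z
  simp only [mul_div_assoc]
  rw [lintegral_const_mul]
  · rfl
  · exact (hK.comp measurable_prodMk_right).div (measurable_potential hK h.1)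

/-- The quotient is not yet `1`: in `ℝ≥0∞` it equals `0` where the potential is `0` or `∞`. -/
theorem fst_plan_eq (hK : Measurable K) (hg : Measurable g) :
    (schrodingerPlan ℓ Q K g).fst =
      Q.withDensity (fun x => potential ℓ K g x / potential ℓ K g x) := by
  rw [schrodingerPlan, fst_prod_withDensity _ _ (measurable_planDensity hK hg)]
  congr 1
  funext x
  simp only [div_eq_mul_inv]
  rw [lintegral_mul_const]
  · rfl
  · exact hg.coe_nnreal_ennreal.mul (hK.comp measurable_prodMk_left)

variable [IsProbabilityMeasure N]

/-- The denominators of a solution are positive and finite almost everywhere. -/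
theorem IsSchrodinger.potential_ae (hK : Measurable K) (h : IsSchrodinger ℓ Q N K g) :
    ∀ᵐ x ∂Q, potential ℓ K g x ≠ 0 ∧ potential ℓ K g x ≠ ∞ := by
  have hφ := measurable_potential (ℓ := ℓ) hK h.1
  -- The total mass can be read off the second marginal. A quotient that is at most `1` and has
  -- integral `1` equals `1` almost everywhere, which excludes the values `0` and `∞`.
  have hmass : ∫⁻ x, potential ℓ K g x / potential ℓ K g x ∂Q = 1 := by
    have h1 := congrArg (fun M : Measure X => M Set.univ) (fst_plan_eq (ℓ := ℓ) (Q := Q) hK h.1)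
    simp only [withDensity_apply _ MeasurableSet.univ, Measure.restrict_univ] at h1
    rw [← h1, Measure.fst_univ, ← Measure.snd_univ, h.snd_plan hK, measure_univ]
  have hle : ∀ᵐ x ∂Q, potential ℓ K g x / potential ℓ K g x ≤ 1 :=
    .of_forall fun x => ENNReal.div_self_le_one
  have heq := ae_eq_of_ae_le_of_lintegral_le hle (by rw [hmass]; simp) aemeasurable_const
    (by rw [hmass]; simp)
  filter_upwards [heq] with x hx
  constructor <;> intro h0 <;> simp [h0] at hx

theorem IsSchrodinger.fst_plan (hK : Measurable K) (h : IsSchrodinger ℓ Q N K g) :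
    (schrodingerPlan ℓ Q K g).fst = Q := by
  rw [fst_plan_eq hK h.1]
  conv_rhs => rw [← withDensity_one (μ := Q)]
  refine withDensity_congr_ae ?_
  filter_upwards [h.potential_ae hK] with x hx
  exact ENNReal.div_self hx.1 hx.2

theorem IsSchrodinger.isProbabilityMeasure_plan (hK : Measurable K)
    (h : IsSchrodinger ℓ Q N K g) : IsProbabilityMeasure (schrodingerPlan ℓ Q K g) :=
  ⟨by rw [← Measure.fst_univ, h.fst_plan hK, measure_univ]⟩

/-- Expectations of bounded functions under a plan, in terms of its density. -/
theorem IsSchrodinger.integral_plan (hK : Measurable K) (hKtop : ∀ t, K t ≠ ∞)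
    (h : IsSchrodinger ℓ Q N K g) {F : X × Z → ℝ} (hF : Measurable F) {C : ℝ}
    (hC : ∀ t, ‖F t‖ ≤ C) :
    Integrable (fun t => (g t.2 : ℝ) * (K t).toReal / (potential ℓ K g t.1).toReal * F t)
        (Q.prod ℓ) ∧
      ∫ t, F t ∂(schrodingerPlan ℓ Q K g) =
        ∫ t, (g t.2 : ℝ) * (K t).toReal / (potential ℓ K g t.1).toReal * F t ∂(Q.prod ℓ) := by
  have hD := measurable_planDensity (ℓ := ℓ) hK h.1
  have hfin : ∀ᵐ t ∂(Q.prod ℓ), (g t.2 : ℝ≥0∞) * K t / potential ℓ K g t.1 < ∞ := by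
    have h1 : ∀ᵐ t ∂(Q.prod ℓ), potential ℓ K g t.1 ≠ 0 ∧ potential ℓ K g t.1 ≠ ∞ :=
      Measure.quasiMeasurePreserving_fst.ae (h.potential_ae hK)
    filter_upwards [h1] with t ht
    exact ENNReal.div_lt_top (ENNReal.mul_ne_top ENNReal.coe_ne_top (hKtop t)) ht.1
  have := h.isProbabilityMeasure_plan hK
  have hFi : Integrable F (schrodingerPlan ℓ Q K g) :=
    Integrable.of_bound hF.aestronglyMeasurable C (.of_forall hC)
  have heq : ∀ t : X × Z, ((g t.2 : ℝ≥0∞) * K t / potential ℓ K g t.1).toReal • F t =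
      (g t.2 : ℝ) * (K t).toReal / (potential ℓ K g t.1).toReal * F t := fun t => by
    rw [ENNReal.toReal_div, ENNReal.toReal_mul, ENNReal.coe_toReal, smul_eq_mul]
  constructor
  · rw [schrodingerPlan, integrable_withDensity_iff_integrable_smul' hD hfin] at hFi
    simpa only [heq] using hFi
  · rw [schrodingerPlan, integral_withDensity_eq_integral_toReal_smul hD hfin]
    simp only [heq]

/-- Bounds the test functions used for uniqueness. -/
theorem abs_sub_div_add_le_one {a b : ℝ} (ha : 0 ≤ a) (hb : 0 ≤ b) :
    |(a - b) / (a + b)| ≤ 1 := by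
  rw [abs_div, abs_of_nonneg (add_nonneg ha hb)]
  refine div_le_one_of_le₀ ?_ (add_nonneg ha hb)
  rw [abs_le]; constructor <;> linarith

/-- Two solutions of the Schrödinger equation differ by a positive factor. -/
theorem IsSchrodinger.unique (hK : Measurable K) (hK0 : ∀ t, K t ≠ 0) (hKtop : ∀ t, K t ≠ ∞)
    (h : IsSchrodinger ℓ Q N K g) (h' : IsSchrodinger ℓ Q N K g') :
    ∃ c : ℝ≥0, 0 < c ∧ g' =ᵐ[ℓ] fun z => c * g z := by
  set φ : X → ℝ := fun x => (potential ℓ K g x).toReal with hφ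
  set φ' : X → ℝ := fun x => (potential ℓ K g' x).toReal with hφ'
  have hφm : Measurable φ := (measurable_potential hK h.1).ennreal_toReal
  have hφm' : Measurable φ' := (measurable_potential hK h'.1).ennreal_toReal
  have hgm : Measurable fun z => (g z : ℝ) := h.1.coe_nnreal_real
  have hgm' : Measurable fun z => (g' z : ℝ) := h'.1.coe_nnreal_real
  have hφpos : ∀ᵐ x ∂Q, 0 < φ x ∧ 0 < φ' x := by
    filter_upwards [h.potential_ae hK, h'.potential_ae hK] with x hx hx'
    exact ⟨ENNReal.toReal_pos hx.1 hx.2, ENNReal.toReal_pos hx'.1 hx'.2⟩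
  -- Bounded substitutes for `log (φ / φ')` and `log (g' / g)`. Where `g + g' > 0`, the sum `A + B`
  -- has the sign of `g' φ - g φ'`, as has the difference of the two plan densities; elsewhere both
  -- densities vanish.
  let A : X → ℝ := fun x => (φ x - φ' x) / (φ x + φ' x)
  let B : Z → ℝ := fun z => ((g' z : ℝ) - g z) / (g' z + g z)
  have hAm : Measurable A := (hφm.sub hφm').div (hφm.add hφm')
  have hBm : Measurable B := (hgm'.sub hgm).div (hgm'.add hgm)
  have hA1 : ∀ x, ‖A x‖ ≤ 1 := fun x =>
    abs_sub_div_add_le_one ENNReal.toReal_nonneg ENNReal.toReal_nonneg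
  have hB1 : ∀ z, ‖B z‖ ≤ 1 := fun z =>
    abs_sub_div_add_le_one (g' z).coe_nonneg (g z).coe_nonneg
  have hFm : Measurable fun t : X × Z => A t.1 + B t.2 :=
    (hAm.comp measurable_fst).add (hBm.comp measurable_snd)
  have hF2 : ∀ t : X × Z, ‖A t.1 + B t.2‖ ≤ 2 := fun t =>
    (norm_add_le _ _).trans (by linarith [hA1 t.1, hB1 t.2])
  have hmarg : ∀ P : Measure (X × Z), IsProbabilityMeasure P → P.fst = Q → P.snd = N →
      ∫ t, A t.1 + B t.2 ∂P = ∫ x, A x ∂Q + ∫ z, B z ∂N := by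
    intro P hP hP1 hP2
    rw [integral_add]
    · rw [← hP1, ← hP2, Measure.fst, Measure.snd,
        integral_map measurable_fst.aemeasurable hAm.aestronglyMeasurable,
        integral_map measurable_snd.aemeasurable hBm.aestronglyMeasurable]
    · exact Integrable.of_bound (hAm.comp measurable_fst).aestronglyMeasurable 1
        (.of_forall fun t => hA1 _)
    · exact Integrable.of_bound (hBm.comp measurable_snd).aestronglyMeasurable 1
        (.of_forall fun t => hB1 _)
  obtain ⟨hi, he⟩ := h.integral_plan hK hKtop hFm hF2
  obtain ⟨hi', he'⟩ := h'.integral_plan hK hKtop hFm hF2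
  rw [hmarg _ (h.isProbabilityMeasure_plan hK) (h.fst_plan hK) (h.snd_plan hK)] at he
  rw [hmarg _ (h'.isProbabilityMeasure_plan hK) (h'.fst_plan hK) (h'.snd_plan hK)] at he'
  -- Both plans give `A + B` the same integral, as it depends on the marginals only.
  have hzero := integral_sub hi' hi
  rw [← he, ← he', sub_self] at hzero
  have hφpos2 : ∀ᵐ t ∂(Q.prod ℓ), 0 < φ t.1 ∧ 0 < φ' t.1 :=
    Measure.quasiMeasurePreserving_fst.ae hφpos
  have hform : ∀ᵐ t ∂(Q.prod ℓ),
      (g' t.2 : ℝ) * (K t).toReal / φ' t.1 * (A t.1 + B t.2) -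
        (g t.2 : ℝ) * (K t).toReal / φ t.1 * (A t.1 + B t.2) =
      2 * (K t).toReal * ((g' t.2 : ℝ) * φ t.1 - g t.2 * φ' t.1) ^ 2 /
        (φ t.1 * φ' t.1 * (φ t.1 + φ' t.1) * (g' t.2 + g t.2)) := by
    filter_upwards [hφpos2] with t ht
    have h1 := ht.1
    have h2 := ht.2
    simp only [A, B]
    rcases (add_nonneg (g' t.2).coe_nonneg (g t.2).coe_nonneg).eq_or_lt with h0 | h0
    · have e1 : (g' t.2 : ℝ) = 0 := by
        linarith [(g' t.2).coe_nonneg, (g t.2).coe_nonneg]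
      have e2 : (g t.2 : ℝ) = 0 := by
        linarith [(g' t.2).coe_nonneg, (g t.2).coe_nonneg]
      simp [e1, e2]
    · have h3 : φ t.1 + φ' t.1 ≠ 0 := by positivity
      have h4 := h0.ne'
      field_simp
      ring
  have hnn : 0 ≤ᵐ[Q.prod ℓ] fun t => (g' t.2 : ℝ) * (K t).toReal / φ' t.1 * (A t.1 + B t.2) -
      (g t.2 : ℝ) * (K t).toReal / φ t.1 * (A t.1 + B t.2) := by
    filter_upwards [hform, hφpos2] with t ht hp
    rw [ht]
    have h1 := hp.1
    have h2 := hp.2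
    simp only [Pi.zero_apply]
    positivity
  have hae := (integral_eq_zero_iff_of_nonneg_ae hnn (hi'.sub hi)).1 hzero
  have hcross : ∀ᵐ t ∂(Q.prod ℓ), (g' t.2 : ℝ) * φ t.1 = g t.2 * φ' t.1 := by
    filter_upwards [hae, hform, hφpos2] with t h0 hf hp
    simp only [Pi.zero_apply] at h0
    rw [hf] at h0
    rcases (add_nonneg (g' t.2).coe_nonneg (g t.2).coe_nonneg).eq_or_lt with hs | hs
    · have e1 : (g' t.2 : ℝ) = 0 := by
        linarith [(g' t.2).coe_nonneg, (g t.2).coe_nonneg]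
      have e2 : (g t.2 : ℝ) = 0 := by
        linarith [(g' t.2).coe_nonneg, (g t.2).coe_nonneg]
      rw [e1, e2, zero_mul, zero_mul]
    · have h1 := hp.1
      have h2 := hp.2
      have h3 : 0 < (K t).toReal := ENNReal.toReal_pos (hK0 t) (hKtop t)
      have h4 : 0 < φ t.1 * φ' t.1 * (φ t.1 + φ' t.1) * (g' t.2 + g t.2) := by positivity
      rw [div_eq_zero_iff, or_iff_left h4.ne', mul_eq_zero,
        or_iff_right (mul_pos two_pos h3).ne', sq_eq_zero_iff, sub_eq_zero] at h0
      exact h0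
  -- Freezing one good `x` in `g' φ = g φ'` exhibits the constant `φ' x / φ x`.
  obtain ⟨x, hx, hxp⟩ := ((Measure.ae_ae_of_ae_prod hcross).and hφpos).exists
  refine ⟨(φ' x / φ x).toNNReal, Real.toNNReal_pos.2 (div_pos hxp.2 hxp.1), ?_⟩
  filter_upwards [hx] with z hz
  apply NNReal.coe_injective
  have := hxp.1.ne'
  rw [NNReal.coe_mul, Real.coe_toNNReal _ (div_pos hxp.2 hxp.1).le]
  field_simp
  linarith

end Solutions

/-! ### The entropy problem -/

section Entropy

/-- Truncation of a real number to `[-n, n]`. -/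
def clip (n : ℕ) (a : ℝ) : ℝ := max (-n) (min a n)

theorem continuous_clip (n : ℕ) : Continuous (clip n) := by unfold clip; fun_prop

theorem abs_clip_le (n : ℕ) (a : ℝ) : |clip n a| ≤ n := by
  have : (0 : ℝ) ≤ n := n.cast_nonneg
  rw [abs_le, clip]
  exact ⟨le_max_left _ _, max_le (by linarith) (min_le_right _ _)⟩

theorem clip_eventually_eq (a : ℝ) : ∀ᶠ n : ℕ in atTop, clip n a = a := by
  obtain ⟨m, hm⟩ := exists_nat_ge |a|
  filter_upwards [eventually_ge_atTop m] with n hn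
  have h1 : |a| ≤ n := hm.trans (by exact_mod_cast hn)
  rw [abs_le] at h1
  rw [clip, min_eq_left h1.2, max_eq_right h1.1]

/-- `clip n` is odd, nondecreasing and 1-Lipschitz, so `clip n a - clip n (-b)` is at most `a + b`
if `a ≥ -b`, and at most `0` otherwise. This provides bounds uniform in `n`. -/
theorem clip_add_clip_pos_le (n : ℕ) (a b : ℝ) :
    max (clip n a + clip n b) 0 ≤ max (a + b) 0 := by
  have : (0 : ℝ) ≤ n := n.cast_nonneg
  unfold clip
  rcases max_cases (-(n : ℝ)) (min a n) with h1 | h1 <;>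
  rcases max_cases (-(n : ℝ)) (min b n) with h2 | h2 <;>
  rcases min_cases a (n : ℝ) with h3 | h3 <;>
  rcases min_cases b (n : ℝ) with h4 | h4 <;>
  refine max_le ?_ (le_max_right _ _) <;>
  rw [le_max_iff] <;>
  first
  | (left; linarith)
  | (right; linarith)

theorem clip_neg (n : ℕ) (a : ℝ) : clip n (-a) = -clip n a := by
  have : (0 : ℝ) ≤ n := n.cast_nonneg
  unfold clip
  rcases max_cases (-(n : ℝ)) (min a n) with h1 | h1 <;>
  rcases max_cases (-(n : ℝ)) (min (-a) n) with h2 | h2 <;>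
  rcases min_cases a (n : ℝ) with h3 | h3 <;>
  rcases min_cases (-a) (n : ℝ) with h4 | h4 <;>
  linarith

theorem clip_add_clip_neg_le (n : ℕ) (a b : ℝ) :
    max (-(clip n a + clip n b)) 0 ≤ max (-(a + b)) 0 := by
  have := clip_add_clip_pos_le n (-a) (-b)
  rwa [clip_neg, clip_neg, ← neg_add, ← neg_add] at this

/-- Fatou's lemma as an integrability criterion. -/
theorem integrable_of_tendsto_of_integral_le {Ω : Type*} [MeasurableSpace Ω] {μ : Measure Ω}
    {F : ℕ → Ω → ℝ} {G : Ω → ℝ} {C : ℝ} (hF : ∀ n, Integrable (F n) μ) (hF0 : ∀ n ω, 0 ≤ F n ω)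
    (hG : Measurable G) (hG0 : ∀ ω, 0 ≤ G ω) (hC : ∀ n, ∫ ω, F n ω ∂μ ≤ C)
    (hlim : ∀ ω, Tendsto (fun n => F n ω) atTop (𝓝 (G ω))) : Integrable G μ := by
  refine ⟨hG.aestronglyMeasurable, ?_⟩
  rw [hasFiniteIntegral_iff_ofReal (.of_forall hG0)]
  have h1 : ∀ ω, ENNReal.ofReal (G ω) = liminf (fun n => ENNReal.ofReal (F n ω)) atTop := fun ω =>
    ((ENNReal.continuous_ofReal.tendsto _).comp (hlim ω)).liminf_eq.symm
  calc ∫⁻ ω, ENNReal.ofReal (G ω) ∂μ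
      = ∫⁻ ω, liminf (fun n => ENNReal.ofReal (F n ω)) atTop ∂μ := by simp only [h1]
    _ ≤ liminf (fun n => ∫⁻ ω, ENNReal.ofReal (F n ω) ∂μ) atTop :=
        lintegral_liminf_le' fun n => (hF n).aemeasurable.ennreal_ofReal
    _ ≤ liminf (fun _ : ℕ => ENNReal.ofReal C) atTop := by
        refine liminf_le_liminf (.of_forall fun n => ?_)
        rw [← ofReal_integral_eq_lintegral_ofReal (hF n) (.of_forall (hF0 n))]
        exact ENNReal.ofReal_le_ofReal (hC n)
    _ < ∞ := by simp

/-- The negative part of the log-likelihood ratio is integrable. -/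
theorem integrable_llr_negPart {Ω : Type*} [MeasurableSpace Ω] {μ ν : Measure Ω}
    [IsFiniteMeasure μ] [IsFiniteMeasure ν] (hμν : μ ≪ ν) :
    Integrable (fun ω => max (-llr μ ν ω) 0) μ := by
  have hm : Measurable fun ω => max (-llr μ ν ω) 0 := (measurable_llr μ ν).neg.max measurable_const
  refine ⟨hm.aestronglyMeasurable, ?_⟩
  have h0 : 0 ≤ᵐ[μ] fun ω => max (-llr μ ν ω) 0 := .of_forall fun ω => le_max_right _ _
  rw [hasFiniteIntegral_iff_ofReal h0]
  -- Under `ν` the integrand becomes `r max (-log r) 0`, which is at most `1`.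
  rw [← lintegral_rnDeriv_mul hμν hm.ennreal_ofReal.aemeasurable]
  refine lt_of_le_of_lt (lintegral_mono_ae (g := fun _ => 1) ?_) (by simp)
  filter_upwards [Measure.rnDeriv_lt_top μ ν] with ω hω
  simp only [llr]
  set r := (μ.rnDeriv ν ω).toReal with hr
  have hr0 : 0 ≤ r := ENNReal.toReal_nonneg
  rw [← ENNReal.ofReal_toReal hω.ne, ← hr, ← ENNReal.ofReal_mul hr0, ← ENNReal.ofReal_one]
  refine ENNReal.ofReal_le_ofReal ?_
  rcases hr0.eq_or_lt with h0 | h0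
  · rw [← h0]; simp
  · rw [mul_max_of_nonneg _ _ hr0]
    refine max_le ?_ (by simp)
    have := Real.log_le_sub_one_of_pos (inv_pos.2 h0)
    rw [Real.log_inv] at this
    calc r * -Real.log r ≤ r * (r⁻¹ - 1) := by gcongr
      _ ≤ 1 := by rw [mul_sub, mul_inv_cancel₀ h0.ne']; linarith

/-- The chain rule for Radon–Nikodym derivatives; `π`-almost everywhere the factors are positive and
finite, so the logarithm splits. -/
theorem llr_add_llr {Ω : Type*} [MeasurableSpace Ω] {π m R : Measure Ω} [SigmaFinite π]
    [SigmaFinite m] [SigmaFinite R] (hπm : π ≪ m) (hmR : m ≪ R) :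
    llr π R =ᵐ[π] fun ω => llr π m ω + llr m R ω := by
  have hπR := hπm.trans hmR
  filter_upwards [hπR.ae_le (Measure.rnDeriv_mul_rnDeriv (κ := R) hπm), Measure.rnDeriv_pos hπm,
    hπm.ae_le (Measure.rnDeriv_lt_top π m), hπm.ae_le (Measure.rnDeriv_pos hmR),
    hπR.ae_le (Measure.rnDeriv_lt_top m R)] with ω h1 h2 h3 h4 h5
  simp only [llr]
  rw [← h1, Pi.mul_apply, ENNReal.toReal_mul, Real.log_mul (ENNReal.toReal_pos h2.ne' h3.ne).ne'
    (ENNReal.toReal_pos h4.ne' h5.ne).ne']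

theorem klDiv_eq_ofReal_integral_llr {Ω : Type*} [MeasurableSpace Ω] {μ ν : Measure Ω}
    [IsProbabilityMeasure μ] [IsProbabilityMeasure ν] (hμν : μ ≪ ν)
    (hi : Integrable (llr μ ν) μ) :
    klDiv μ ν = ENNReal.ofReal (∫ ω, llr μ ν ω ∂μ) ∧ 0 ≤ ∫ ω, llr μ ν ω ∂μ := by
  have h := integral_llr_add_sub_measure_univ_nonneg hμν hi
  rw [klDiv_of_ac_of_integrable hμν hi]
  simpa using h

variable {X Z : Type*} [MeasurableSpace X] [MeasurableSpace Z]

/-- The integrals of `U(z) + V(x)` under two couplings of the same marginals agree, if the positive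
part is integrable under one of them and the negative part under the other one. -/
theorem integral_add_eq_of_marginals {π m : Measure (X × Z)} [IsProbabilityMeasure π]
    [IsProbabilityMeasure m] (hfst : π.fst = m.fst) (hsnd : π.snd = m.snd) {U : Z → ℝ} {V : X → ℝ}
    (hU : Measurable U) (hV : Measurable V)
    (hpos : Integrable (fun t : X × Z => max (U t.2 + V t.1) 0) π)
    (hneg : Integrable (fun t : X × Z => max (-(U t.2 + V t.1)) 0) m) :
    Integrable (fun t : X × Z => U t.2 + V t.1) π ∧ Integrable (fun t : X × Z => U t.2 + V t.1) m ∧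
      ∫ t, U t.2 + V t.1 ∂π = ∫ t, U t.2 + V t.1 ∂m := by
  -- The truncated summands are bounded, so their integrals can be split and compared through the
  -- marginals.
  let T : ℕ → X × Z → ℝ := fun n t => clip n (U t.2) + clip n (V t.1)
  have hUm : ∀ n, Measurable fun z => clip n (U z) := fun n =>
    (continuous_clip n).measurable.comp hU
  have hVm : ∀ n, Measurable fun x => clip n (V x) := fun n =>
    (continuous_clip n).measurable.comp hV
  have hLm : Measurable fun t : X × Z => U t.2 + V t.1 :=
    (hU.comp measurable_snd).add (hV.comp measurable_fst)
  have hi1 : ∀ n (ξ : Measure (X × Z)) [IsProbabilityMeasure ξ],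
      Integrable (fun t : X × Z => clip n (U t.2)) ξ := fun n ξ _ =>
    Integrable.of_bound ((hUm n).comp measurable_snd).aestronglyMeasurable n
      (.of_forall fun t => abs_clip_le _ _)
  have hi2 : ∀ n (ξ : Measure (X × Z)) [IsProbabilityMeasure ξ],
      Integrable (fun t : X × Z => clip n (V t.1)) ξ := fun n ξ _ =>
    Integrable.of_bound ((hVm n).comp measurable_fst).aestronglyMeasurable n
      (.of_forall fun t => abs_clip_le _ _)
  have hT : ∀ n (ξ : Measure (X × Z)) [IsProbabilityMeasure ξ], Integrable (T n) ξ :=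
    fun n ξ _ => (hi1 n ξ).add (hi2 n ξ)
  have hTeq : ∀ n, ∫ t, T n t ∂π = ∫ t, T n t ∂m := by
    have hint : ∀ n (ξ : Measure (X × Z)) [IsProbabilityMeasure ξ],
        ∫ t, T n t ∂ξ = ∫ z, clip n (U z) ∂ξ.snd + ∫ x, clip n (V x) ∂ξ.fst := by
      intro n ξ _
      rw [Measure.fst, Measure.snd,
        integral_map measurable_fst.aemeasurable (hVm n).aestronglyMeasurable,
        integral_map measurable_snd.aemeasurable (hUm n).aestronglyMeasurable]
      exact integral_add (hi1 n ξ) (hi2 n ξ)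
    intro n
    rw [hint, hint, hfst, hsnd]
  have hTlim : ∀ t, Tendsto (fun n => T n t) atTop (𝓝 (U t.2 + V t.1)) := fun t =>
    tendsto_const_nhds.congr' ((clip_eventually_eq (U t.2)).and (clip_eventually_eq (V t.1)) |>.mono
      fun n hn => by simp only [T, hn.1, hn.2])
  -- Rearranged so that the right side carries the two parts controlled by `hpos` and `hneg`; it
  -- then bounds the other two uniformly in `n`.
  have hbal : ∀ n, ∫ t, max (T n t) 0 ∂m + ∫ t, max (-T n t) 0 ∂π =
      ∫ t, max (T n t) 0 ∂π + ∫ t, max (-T n t) 0 ∂m := by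
    intro n
    have hsplit : ∀ (ξ : Measure (X × Z)) [IsProbabilityMeasure ξ],
        ∫ t, T n t ∂ξ = ∫ t, max (T n t) 0 ∂ξ - ∫ t, max (-T n t) 0 ∂ξ := by
      intro ξ _
      rw [← integral_sub (hT n ξ).pos_part (hT n ξ).neg_part]
      refine integral_congr_ae (.of_forall fun t => ?_)
      change T n t = max (T n t) 0 - max (-T n t) 0
      rcases le_total (T n t) 0 with h | h
      · rw [max_eq_right h, max_eq_left (by linarith)]; ring
      · rw [max_eq_left h, max_eq_right (by linarith)]; ring
    have := hTeq n
    rw [hsplit π, hsplit m] at this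
    linarith
  let C : ℝ := ∫ t, max (U t.2 + V t.1) 0 ∂π + ∫ t, max (-(U t.2 + V t.1)) 0 ∂m
  have hbound : ∀ n, ∫ t, max (T n t) 0 ∂π + ∫ t, max (-T n t) 0 ∂m ≤ C := fun n =>
    add_le_add
      (integral_mono (hT n π).pos_part hpos fun t => clip_add_clip_pos_le _ _ _)
      (integral_mono (hT n m).neg_part hneg fun t => clip_add_clip_neg_le _ _ _)
  have hposm : Integrable (fun t : X × Z => max (U t.2 + V t.1) 0) m := by
    refine integrable_of_tendsto_of_integral_le (F := fun n t => max (T n t) 0) (C := C)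
      (fun n => (hT n m).pos_part) (fun n t => le_max_right _ _) (hLm.max measurable_const)
      (fun t => le_max_right _ _) (fun n => ?_) (fun t => (hTlim t).max tendsto_const_nhds)
    · have h1 : 0 ≤ ∫ t, max (-T n t) 0 ∂π := integral_nonneg fun t => le_max_right _ _
      linarith [hbal n, hbound n]
  have hnegπ : Integrable (fun t : X × Z => max (-(U t.2 + V t.1)) 0) π := by
    refine integrable_of_tendsto_of_integral_le (F := fun n t => max (-T n t) 0) (C := C)
      (fun n => (hT n π).neg_part) (fun n t => le_max_right _ _) (hLm.neg.max measurable_const)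
      (fun t => le_max_right _ _) (fun n => ?_) (fun t => (hTlim t).neg.max tendsto_const_nhds)
    · have h1 : 0 ≤ ∫ t, max (T n t) 0 ∂m := integral_nonneg fun t => le_max_right _ _
      linarith [hbal n, hbound n]
  have hcomb : ∀ ξ : Measure (X × Z), Integrable (fun t : X × Z => max (U t.2 + V t.1) 0) ξ →
      Integrable (fun t : X × Z => max (-(U t.2 + V t.1)) 0) ξ →
      Integrable (fun t : X × Z => U t.2 + V t.1) ξ ∧
        Tendsto (fun n => ∫ t, T n t ∂ξ) atTop (𝓝 (∫ t, U t.2 + V t.1 ∂ξ)) := by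
    intro ξ h1 h2
    refine ⟨(h1.sub h2).congr (.of_forall fun t => ?_), ?_⟩
    · change max (U t.2 + V t.1) 0 - max (-(U t.2 + V t.1)) 0 = U t.2 + V t.1
      rcases le_total (U t.2 + V t.1) 0 with h | h
      · rw [max_eq_right h, max_eq_left (by linarith)]; ring
      · rw [max_eq_left h, max_eq_right (by linarith)]; ring
    · refine tendsto_integral_of_dominated_convergence _
        (fun n => (((hUm n).comp measurable_snd).add
          ((hVm n).comp measurable_fst)).aestronglyMeasurable) (h1.add h2)
        (fun n => .of_forall fun t => ?_) (.of_forall hTlim)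
      have h3 := clip_add_clip_pos_le n (U t.2) (V t.1)
      have h4 := clip_add_clip_neg_le n (U t.2) (V t.1)
      rw [Real.norm_eq_abs, abs_le]
      simp only [Pi.add_apply]
      have h5 := le_max_left (clip n (U t.2) + clip n (V t.1)) 0
      have h6 := le_max_left (-(clip n (U t.2) + clip n (V t.1))) 0
      have h7 := le_max_right (U t.2 + V t.1) 0
      have h8 := le_max_right (-(U t.2 + V t.1)) 0
      constructor <;> linarith
  obtain ⟨hπ1, hπ2⟩ := hcomb π hpos hnegπ
  obtain ⟨hm1, hm2⟩ := hcomb m hposm hneg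
  exact ⟨hπ1, hm1, tendsto_nhds_unique hπ2 (hm2.congr fun n => (hTeq n).symm)⟩

/-- The Pythagorean identity for the relative entropy, for a plan `m` whose density with respect to
`R` is a product. -/
theorem klDiv_eq_klDiv_add_klDiv {π m R : Measure (X × Z)} [IsProbabilityMeasure π]
    [IsProbabilityMeasure m] [IsProbabilityMeasure R] (hfst : π.fst = m.fst)
    (hsnd : π.snd = m.snd) (hπm : π ≪ m) (hmR : m ≪ R) {U : Z → ℝ} {V : X → ℝ}
    (hU : Measurable U) (hV : Measurable V)
    (hL : ∀ᵐ t ∂m, llr m R t = U t.2 + V t.1) (hfin : klDiv π R ≠ ∞) :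
    klDiv π R = klDiv π m + klDiv m R := by
  have hLπ := hπm.ae_le hL
  obtain ⟨hπR, hi⟩ := klDiv_ne_top_iff.1 hfin
  have hchain : ∀ᵐ t ∂π, llr π R t = llr π m t + (U t.2 + V t.1) := by
    filter_upwards [llr_add_llr hπm hmR, hLπ] with t h1 h2
    rw [h1, ← h2]
  have hLm : Measurable fun t : X × Z => U t.2 + V t.1 :=
    (hU.comp measurable_snd).add (hV.comp measurable_fst)
  have hneg : Integrable (fun t : X × Z => max (-(U t.2 + V t.1)) 0) m :=
    (integrable_llr_negPart hmR).congr (hL.mono fun t ht => by simp only [ht])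
  -- By the chain rule the positive part of `U + V` is at most `|llr π R|` plus the negative part of
  -- `llr π m`.
  have hpos : Integrable (fun t : X × Z => max (U t.2 + V t.1) 0) π := by
    refine (hi.abs.add (integrable_llr_negPart hπm)).mono'
      (hLm.max measurable_const).aestronglyMeasurable ?_
    filter_upwards [hchain] with t ht
    rw [Real.norm_of_nonneg (le_max_right _ _)]
    simp only [Pi.add_apply]
    have h1 := le_abs_self (llr π R t)
    have h2 := le_max_left (-llr π m t) 0
    have h3 := le_max_right (-llr π m t) 0
    have h4 := abs_nonneg (llr π R t)
    exact max_le (by linarith) (by linarith)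
  obtain ⟨hLπi, hLmi, hLeq⟩ := integral_add_eq_of_marginals hfst hsnd hU hV hpos hneg
  have hllrm : Integrable (llr m R) m := hLmi.congr (hL.mono fun t ht => ht.symm)
  have hllrπ : Integrable (llr π m) π := (hi.sub hLπi).congr (hchain.mono fun t ht => by
    simp only [Pi.sub_apply, ht]; ring)
  obtain ⟨e1, n1⟩ := klDiv_eq_ofReal_integral_llr hπR hi
  obtain ⟨e2, n2⟩ := klDiv_eq_ofReal_integral_llr hπm hllrπ
  obtain ⟨e3, n3⟩ := klDiv_eq_ofReal_integral_llr hmR hllrm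
  rw [e1, e2, e3, ← ENNReal.ofReal_add n2 n3, integral_congr_ae hchain, integral_congr_ae hL,
    integral_add hllrπ hLπi, hLeq]

end Entropy

/-! ### Minimality of the Schrödinger plan -/

section Minimizer

variable {X Z : Type*} [MeasurableSpace X] [MeasurableSpace Z] {ℓ : Measure Z} [SigmaFinite ℓ]
  {Q : Measure X} {N : Measure Z} {K : X × Z → ℝ≥0∞} {g : Z → ℝ≥0}

/-- With `K` moved into the reference measure, the remaining density is a function of `z` times a
function of `x`. -/
theorem schrodingerPlan_eq_withDensity (hK : Measurable K) (hg : Measurable g) :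
    schrodingerPlan ℓ Q K g = ((Q.prod ℓ).withDensity K).withDensity
      (fun t => (g t.2 : ℝ≥0∞) / potential ℓ K g t.1) := by
  have hw : Measurable fun t : X × Z => (g t.2 : ℝ≥0∞) / potential ℓ K g t.1 :=
    (hg.comp measurable_snd).coe_nnreal_ennreal.div
      ((measurable_potential hK hg).comp measurable_fst)
  rw [schrodingerPlan, ← withDensity_mul _ hK hw]
  congr 1
  funext t
  simp only [Pi.mul_apply, div_eq_mul_inv]
  ring

variable [IsProbabilityMeasure Q] [IsProbabilityMeasure N]

theorem IsSchrodinger.plan_mem_couplings (hK : Measurable K) (h : IsSchrodinger ℓ Q N K g) :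
    schrodingerPlan ℓ Q K g ∈ couplings Q N :=
  ⟨h.isProbabilityMeasure_plan hK, h.fst_plan hK, h.snd_plan hK⟩

/-- The factors of the density of the plan are positive and finite almost everywhere under every
coupling. -/
theorem IsSchrodinger.factors_ae (hK : Measurable K) (h : IsSchrodinger ℓ Q N K g)
    {π : Measure (X × Z)} (hπ : π ∈ couplings Q N) :
    ∀ᵐ t ∂π, g t.2 ≠ 0 ∧ potential ℓ K g t.1 ≠ 0 ∧ potential ℓ K g t.1 ≠ ∞ := by
  have h1 : ∀ᵐ z ∂N, g z ≠ 0 := by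
    have hset : MeasurableSet {z | g z = 0} := h.1 (measurableSet_singleton 0)
    rw [ae_iff]
    simp only [not_not]
    rw [h.2, withDensity_apply _ hset, setLIntegral_eq_zero_iff hset]
    · exact .of_forall fun z hz => by
        have hz : g z = 0 := hz
        simp only [hz, ENNReal.coe_zero, zero_mul]
    · refine h.1.coe_nnreal_ennreal.mul ?_
      exact Measurable.lintegral_prod_left'
        (f := fun t : X × Z => K t / potential ℓ K g t.1)
        (hK.div ((measurable_potential hK h.1).comp measurable_fst))
  have h2 := h.potential_ae hK
  rw [← hπ.2.2] at h1
  rw [← hπ.2.1] at h2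
  filter_upwards [ae_of_ae_map measurable_snd.aemeasurable h1,
    ae_of_ae_map measurable_fst.aemeasurable h2] with t ht1 ht2
  exact ⟨ht1, ht2⟩

/-- A Schrödinger plan is the unique minimizer of the relative entropy among couplings, if the
minimal entropy is finite. -/
theorem IsSchrodinger.isUniqueMinimizer (hK : Measurable K)
    (hK1 : ∀ x, ∫⁻ z, K (x, z) ∂ℓ = 1) (h : IsSchrodinger ℓ Q N K g)
    (hfin : entropyValue Q N ((Q.prod ℓ).withDensity K) < ∞) :
    IsUniqueMinimizer Q N ((Q.prod ℓ).withDensity K) (schrodingerPlan ℓ Q K g) := by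
  set R := (Q.prod ℓ).withDensity K with hRdef
  set m := schrodingerPlan ℓ Q K g with hmdef
  have hR : IsProbabilityMeasure R := ⟨by
    rw [← Measure.fst_univ, hRdef, fst_prod_withDensity _ _ hK]
    simp only [hK1]
    simp⟩
  have hmc : m ∈ couplings Q N := h.plan_mem_couplings hK
  have hm : IsProbabilityMeasure m := hmc.1
  let w : X × Z → ℝ≥0∞ := fun t => (g t.2 : ℝ≥0∞) / potential ℓ K g t.1
  have hw : Measurable w := (h.1.comp measurable_snd).coe_nnreal_ennreal.div
    ((measurable_potential hK h.1).comp measurable_fst)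
  have hmR : m = R.withDensity w := schrodingerPlan_eq_withDensity hK h.1
  have hmac : m ≪ R := hmR ▸ withDensity_absolutelyContinuous _ _
  have hL : ∀ᵐ t ∂m, llr m R t =
      Real.log (g t.2) + -Real.log (potential ℓ K g t.1).toReal := by
    have h1 : m.rnDeriv R =ᵐ[R] w := by rw [hmR]; exact Measure.rnDeriv_withDensity R hw
    filter_upwards [hmac.ae_le h1, h.factors_ae hK hmc] with t ht1 ht2
    have h3 : (g t.2 : ℝ) ≠ 0 := by exact_mod_cast ht2.1
    rw [llr, ht1, ENNReal.toReal_div, ENNReal.coe_toReal,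
      Real.log_div h3 (ENNReal.toReal_pos ht2.2.1 ht2.2.2).ne', sub_eq_add_neg]
  have key : ∀ π ∈ couplings Q N, klDiv π R ≠ ∞ → klDiv π R = klDiv π m + klDiv m R := by
    intro π hπ hne
    have : IsProbabilityMeasure π := hπ.1
    have hπR := (klDiv_ne_top_iff.1 hne).1
    -- From `π ≪ R`: an `m`-null set is `R`-null apart from `{w = 0}`. There `g` is `0` or the
    -- potential is `∞`, which the marginals make `π`-null for every coupling.
    have hπm : π ≪ m := by
      intro A hA
      rw [hmR, withDensity_apply_eq_zero hw] at hA
      refine measure_mono_null (fun t ht => ?_)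
        (measure_union_null (hπR hA) (ae_iff.1 (h.factors_ae hK hπ)))
      by_cases h0 : w t = 0
      · refine Or.inr fun hc => ?_
        rw [ENNReal.div_eq_zero_iff] at h0
        rcases h0 with h0 | h0
        · exact hc.1 (by exact_mod_cast h0)
        · exact hc.2.2 h0
      · exact Or.inl ⟨h0, ht⟩
    refine klDiv_eq_klDiv_add_klDiv (hπ.2.1.trans hmc.2.1.symm) (hπ.2.2.trans hmc.2.2.symm) hπm hmac
      (U := fun z => Real.log (g z)) (V := fun x => -Real.log (potential ℓ K g x).toReal)
      (Real.measurable_log.comp h.1.coe_nnreal_real)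
      (Real.measurable_log.comp (measurable_potential hK h.1).ennreal_toReal).neg hL hne
  have hval : klDiv m R = entropyValue Q N R := by
    refine le_antisymm (le_iInf₂ fun π hπ => ?_) (iInf₂_le m hmc)
    by_cases hne : klDiv π R = ∞
    · rw [hne]; exact le_top
    · rw [key π hπ hne]; exact le_add_self
  refine ⟨hmc, hval, fun π hπ hπv => ?_⟩
  have : IsProbabilityMeasure π := hπ.1
  have hne : klDiv π R ≠ ∞ := hπv ▸ hfin.ne
  have h1 := key π hπ hne
  rw [hπv, hval] at h1
  -- Cancelling the minimal entropy is legitimate because it is finite.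
  have h2 : klDiv π m = 0 := by
    have h3 : 0 + entropyValue Q N R = klDiv π m + entropyValue Q N R := by rwa [zero_add]
    exact ((ENNReal.add_left_inj hfin.ne).1 h3).symm
  exact klDiv_eq_zero_iff.1 h2

end Minimizer

/-! ### Block coordinates and iterated integrals -/

section Coordinates

variable {d : ℕ → ℕ} {k i : ℕ}

theorem continuous_join : Continuous fun q : E d i × B d (i + 1) => join q.1 q.2 := by
  refine continuous_pi fun l => ?_
  refine Fin.addCases (fun l => ?_) (fun l => ?_) l
  · simp only [join, Fin.append_left]; fun_prop
  · simp only [join, Fin.append_right]; fun_prop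

theorem continuous_glue : Continuous fun q : E d i × Tail d k i => glue q.1 q.2 := by
  refine continuous_pi fun l => ?_
  by_cases hl : (l : ℕ) < nn d i
  · simp only [glue, hl, dite_true]; fun_prop
  · simp only [glue, hl, dite_false]; fun_prop

theorem continuous_trunc {j : ℕ} (h : i ≤ j) : Continuous (trunc (d := d) h) :=
  continuous_pi fun _ => continuous_apply _

theorem trunc_glue (h : i ≤ k) (x : E d i) (w : Tail d k i) : trunc h (glue x w) = x := by
  funext l
  simp [trunc, glue]

theorem trunc_glue_succ (h : i + 1 ≤ k) (x : E d (i + 1)) (w : Tail d k (i + 1)) :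
    trunc (Nat.le_of_succ_le h) (glue x w) = trunc (Nat.le_succ i) x := by
  funext l
  have hl : (l : ℕ) < nn d (i + 1) := l.2.trans_le (nn_mono d (Nat.le_succ i))
  simp only [trunc, glue, Fin.val_castLE, hl, dite_true]
  rfl

/-- The splitting of the indices after the `n_i`-th one. -/
def tailIndexEquiv (d : ℕ → ℕ) (k i : ℕ) (h : i + 1 ≤ k) :
    Fin (d (i + 1)) ⊕ Fin (nn d k - nn d (i + 1)) ≃ Fin (nn d k - nn d i) :=
  finSumFinEquiv.trans (finCongr (by
    have h1 := nn_mono d h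
    have h2 : nn d (i + 1) = nn d i + d (i + 1) := rfl
    omega))

/-- The concatenation `ℝ^{d_{i+1}} × ℝ^{n_k - n_{i+1}} → ℝ^{n_k - n_i}`. -/
def tailJoin (h : i + 1 ≤ k) (q : B d (i + 1) × Tail d k (i + 1)) : Tail d k i :=
  fun l => Sum.elim q.1 q.2 ((tailIndexEquiv d k i h).symm l)

/-- A reindexing of the product Lebesgue measure by an equivalence of index sets. -/
theorem measurePreserving_tailJoin (h : i + 1 ≤ k) :
    MeasurePreserving (tailJoin (d := d) h) (volume.prod volume) volume := by
  have h1 := volume_measurePreserving_sumPiEquivProdPi_symm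
    (fun _ : Fin (d (i + 1)) ⊕ Fin (nn d k - nn d (i + 1)) => ℝ)
  have h2 := volume_measurePreserving_piCongrLeft (fun _ : Fin (nn d k - nn d i) => ℝ)
    (tailIndexEquiv d k i h)
  suffices heq : tailJoin (d := d) h = MeasurableEquiv.piCongrLeft (fun _ => ℝ) (tailIndexEquiv d k i h) ∘
      (MeasurableEquiv.sumPiEquivProdPi fun _ => ℝ).symm by
    rw [heq]
    exact h2.comp h1
  funext q l
  obtain ⟨l', rfl⟩ := (tailIndexEquiv d k i h).surjective l
  simp only [tailJoin, Equiv.symm_apply_apply, Function.comp_apply, MeasurableEquiv.coe_piCongrLeft,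
    Equiv.piCongrLeft_apply_apply]
  rcases l' with l' | l' <;> rfl

/-- Associativity of concatenation, checked on the three ranges of coordinates. -/
theorem glue_tailJoin (h : i + 1 ≤ k) (y : E d i) (z : B d (i + 1)) (w : Tail d k (i + 1)) :
    glue y (tailJoin h (z, w)) = glue (join y z) w := by
  funext l
  have hnn : nn d (i + 1) = nn d i + d (i + 1) := rfl
  have hl := l.2
  by_cases h1 : (l : ℕ) < nn d i
  · have h2 : (l : ℕ) < nn d (i + 1) := by omega
    have h3 : (⟨l, h2⟩ : Fin (nn d i + d (i + 1))) = Fin.castAdd (d (i + 1)) ⟨l, h1⟩ := rfl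
    simp only [glue, h1, h2, dite_true, join]
    exact (congrArg (Fin.append y z) h3).trans (Fin.append_left y z _) |>.symm
  · by_cases h2 : (l : ℕ) < nn d (i + 1)
    · have h3 : (l : ℕ) - nn d i < d (i + 1) := by omega
      have h4 : (⟨l, h2⟩ : Fin (nn d i + d (i + 1))) =
          Fin.natAdd (nn d i) ⟨(l : ℕ) - nn d i, h3⟩ := by
        ext; simp only [Fin.val_natAdd]; omega
      have h5 : (⟨(l : ℕ) - nn d i, by omega⟩ : Fin (nn d k - nn d i)) =
          tailIndexEquiv d k i h (Sum.inl ⟨(l : ℕ) - nn d i, h3⟩) := by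
        ext; simp [tailIndexEquiv]
      simp only [glue, h1, h2, dite_true, dite_false, join, tailJoin]
      rw [h5, Equiv.symm_apply_apply]
      exact ((congrArg (Fin.append y z) h4).trans (Fin.append_right y z _)).symm
    · have h5 : (⟨(l : ℕ) - nn d i, by omega⟩ : Fin (nn d k - nn d i)) =
          tailIndexEquiv d k i h (Sum.inr ⟨(l : ℕ) - nn d (i + 1), by omega⟩) := by
        ext; simp [tailIndexEquiv]; omega
      simp only [glue, h1, h2, dite_false, tailJoin]
      rw [h5, Equiv.symm_apply_apply]
      rfl

/-- Tonelli's theorem in block coordinates; it makes the marginal densities of `p` and of `f`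
consistent between levels. -/
theorem lintegral_join_glue (h : i + 1 ≤ k) (y : E d i) {F : E d k → ℝ≥0∞} (hF : Measurable F) :
    ∫⁻ z : B d (i + 1), ∫⁻ w : Tail d k (i + 1), F (glue (join y z) w) =
      ∫⁻ w : Tail d k i, F (glue y w) := by
  have hglue : Measurable fun w : Tail d k i => F (glue y w) :=
    hF.comp (continuous_glue.measurable.comp measurable_prodMk_left)
  rw [← (measurePreserving_tailJoin h).lintegral_comp hglue, lintegral_prod]
  · simp only [glue_tailJoin]
  · exact (hglue.comp (measurePreserving_tailJoin h).measurable).aemeasurable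

end Coordinates

/-! ### The conditional densities -/

section Densities

variable {d : ℕ → ℕ} {k i : ℕ} {p : E d k → E d k → ℝ}

/-- The tail is empty, and Lebesgue measure on `ℝ^0` has mass one. -/
theorem pMarg_top (x y : E d k) : pMarg d k p k x y = ENNReal.ofReal (p x y) := by
  have : IsEmpty (Fin (nn d k - nn d k)) := by rw [Nat.sub_self]; infer_instance
  have hg : ∀ (x : E d k) (w : Tail d k k), glue x w = x := by
    intro x w
    funext l
    simp [glue]
  simp only [pMarg, hg, lintegral_const, volume_pi, Measure.pi_univ]
  simp

theorem DensityAssumption.pMarg_ne_zero (hp : DensityAssumption d k p) (x y : E d i) :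
    pMarg d k p i x y ≠ 0 := by
  have hF : Measurable fun w : Tail d k i => ENNReal.ofReal (p (glue x 0) (glue y w)) := by
    refine ENNReal.measurable_ofReal.comp (Continuous.measurable ?_)
    exact hp.cont.comp (continuous_const.prodMk
      (continuous_glue.comp (continuous_const.prodMk continuous_id)))
  exact lintegral_ne_zero_of_forall_ne_zero
    (Measure.measure_univ_ne_zero.1 (isOpen_univ.measure_ne_zero _ Set.univ_nonempty)) hF
    fun w => (ENNReal.ofReal_pos.2 (hp.pos _ _)).ne'

theorem DensityAssumption.pMarg_ne_top (hp : DensityAssumption d k p) (hi1 : 1 ≤ i) (hi : i ≤ k)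
    (x y : E d i) : pMarg d k p i x y ≠ ∞ := by
  rcases hi.eq_or_lt with rfl | hlt
  · rw [pMarg_top]; exact ENNReal.ofReal_ne_top
  · exact hp.marg_finite i hi1 hlt x y

theorem DensityAssumption.continuous_pMarg (hp : DensityAssumption d k p) (hi1 : 1 ≤ i)
    (hi : i ≤ k) : Continuous (Function.uncurry (pMarg d k p i)) := by
  rcases hi.eq_or_lt with rfl | hlt
  · have : Function.uncurry (pMarg d i p i) =
        fun t : E d i × E d i => ENNReal.ofReal (Function.uncurry p t) :=
      funext fun t => pMarg_top t.1 t.2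
    rw [this]
    exact ENNReal.continuous_ofReal.comp hp.cont
  · exact hp.marg_cont i hi1 hlt

/-- Tonelli leaves `x` padded by zeros only after its `n_{i+1}`-th coordinate; `indep` moves this to
the padding after the `n_i`-th. -/
theorem DensityAssumption.lintegral_pMarg_succ (hp : DensityAssumption d k p) (hi1 : 1 ≤ i)
    (hi : i + 1 ≤ k) (x : E d (i + 1)) (y : E d i) :
    ∫⁻ z : B d (i + 1), pMarg d k p (i + 1) x (join y z) =
      pMarg d k p i (trunc (Nat.le_succ i) x) y := by
  have hF : Measurable fun v : E d k => ENNReal.ofReal (p (glue x 0) v) :=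
    ENNReal.measurable_ofReal.comp
      (hp.cont.comp (continuous_const.prodMk continuous_id)).measurable
  simp only [pMarg]
  rw [lintegral_join_glue hi y hF]
  refine hp.indep i hi1 hi _ _ ?_ y
  rw [trunc_glue_succ hi, trunc_glue]

/-- The normalizing integral is itself a marginal of `p`, and so inherits positivity, finiteness and
continuity. -/
theorem pCond_eq_div (hp : DensityAssumption d k p) (hi1 : 1 ≤ i) (hi : i + 1 ≤ k)
    (x : E d (i + 1)) (z : B d (i + 1)) (y : E d i) :
    pCond d k p i x z y =
      pMarg d k p (i + 1) x (join y z) / pMarg d k p i (trunc (Nat.le_succ i) x) y := by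
  rw [pCond, hp.lintegral_pMarg_succ hi1 hi]

theorem DensityAssumption.continuous_pMarg_join (hp : DensityAssumption d k p) (hi : i + 1 ≤ k)
    (y : E d i) :
    Continuous fun t : E d (i + 1) × B d (i + 1) => pMarg d k p (i + 1) t.1 (join y t.2) :=
  (hp.continuous_pMarg (Nat.le_add_left 1 i) hi).comp (continuous_fst.prodMk
    (continuous_join.comp (continuous_const.prodMk continuous_snd)))

theorem DensityAssumption.continuous_toReal_pCond (hp : DensityAssumption d k p) (hi1 : 1 ≤ i)
    (hi : i + 1 ≤ k) (y : E d i) :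
    Continuous fun t : E d (i + 1) × B d (i + 1) => (pCond d k p i t.1 t.2 y).toReal := by
  simp only [pCond_eq_div hp hi1 hi, ENNReal.toReal_div]
  refine Continuous.div₀ ?_ ?_ fun t => ?_
  · exact ENNReal.continuousOn_toReal.comp_continuous (hp.continuous_pMarg_join hi y)
      fun t => hp.pMarg_ne_top (Nat.le_add_left 1 i) hi _ _
  · refine ENNReal.continuousOn_toReal.comp_continuous
      ((hp.continuous_pMarg hi1 (Nat.le_of_succ_le hi)).comp
        (((continuous_trunc (Nat.le_succ i)).comp continuous_fst).prodMk continuous_const))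
      fun t => hp.pMarg_ne_top hi1 (Nat.le_of_succ_le hi) _ _
  · exact (ENNReal.toReal_pos (hp.pMarg_ne_zero _ _)
      (hp.pMarg_ne_top hi1 (Nat.le_of_succ_le hi) _ _)).ne'

theorem DensityAssumption.pCond_ne_zero (hp : DensityAssumption d k p) (hi1 : 1 ≤ i)
    (hi : i + 1 ≤ k) (x : E d (i + 1)) (z : B d (i + 1)) (y : E d i) :
    pCond d k p i x z y ≠ 0 := by
  rw [pCond_eq_div hp hi1 hi]
  exact ENNReal.div_ne_zero.2
    ⟨hp.pMarg_ne_zero _ _, hp.pMarg_ne_top hi1 (Nat.le_of_succ_le hi) _ _⟩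

theorem DensityAssumption.pCond_ne_top (hp : DensityAssumption d k p) (hi1 : 1 ≤ i)
    (hi : i + 1 ≤ k) (x : E d (i + 1)) (z : B d (i + 1)) (y : E d i) :
    pCond d k p i x z y ≠ ∞ := by
  rw [pCond_eq_div hp hi1 hi]
  exact ENNReal.div_ne_top (hp.pMarg_ne_top (Nat.le_add_left 1 i) hi _ _) (hp.pMarg_ne_zero _ _)

theorem DensityAssumption.measurable_pCond (hp : DensityAssumption d k p) (hi1 : 1 ≤ i)
    (hi : i + 1 ≤ k) (y : E d i) :
    Measurable fun t : E d (i + 1) × B d (i + 1) => pCond d k p i t.1 t.2 y := by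
  have h1 : (fun t : E d (i + 1) × B d (i + 1) => pCond d k p i t.1 t.2 y) =
      fun t => ENNReal.ofReal (pCond d k p i t.1 t.2 y).toReal :=
    funext fun t => (ENNReal.ofReal_toReal (hp.pCond_ne_top hi1 hi _ _ _)).symm
  rw [h1]
  exact ENNReal.measurable_ofReal.comp (hp.continuous_toReal_pCond hi1 hi y).measurable

theorem DensityAssumption.lintegral_pCond (hp : DensityAssumption d k p) (hi1 : 1 ≤ i)
    (hi : i + 1 ≤ k) (x : E d (i + 1)) (y : E d i) : ∫⁻ z, pCond d k p i x z y = 1 := by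
  have hm : Measurable fun z => pMarg d k p (i + 1) x (join y z) :=
    (hp.continuous_pMarg_join hi y).measurable.comp measurable_prodMk_left
  simp only [pCond_eq_div hp hi1 hi, div_eq_mul_inv]
  rw [lintegral_mul_const _ hm, hp.lintegral_pMarg_succ hi1 hi]
  exact ENNReal.mul_inv_cancel (hp.pMarg_ne_zero _ _)
    (hp.pMarg_ne_top hi1 (Nat.le_of_succ_le hi) _ _)

/-- The two kernels differ by the factor `p_i(x, y)⁻¹`, constant in `z`, which cancels against the
one in the potential. -/
theorem DensityAssumption.planCond_eq (hp : DensityAssumption d k p) (hi1 : 1 ≤ i)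
    (hi : i + 1 ≤ k) (y : E d i) (Q : Measure (E d (i + 1))) (g : B d (i + 1) → ℝ≥0) :
    planCond d k p i y Q g =
      schrodingerPlan volume Q (fun t => pCond d k p i t.1 t.2 y) g := by
  rw [planCond, schrodingerPlan]
  congr 1
  funext t
  set c := pMarg d k p i (trunc (Nat.le_succ i) t.1) y with hc
  have hc0 : c ≠ 0 := hp.pMarg_ne_zero _ _
  have hctop : c ≠ ∞ := hp.pMarg_ne_top hi1 (Nat.le_of_succ_le hi) _ _
  have hcinv : c⁻¹ ≠ 0 := ENNReal.inv_ne_zero.2 hctop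
  have hcinv' : c⁻¹ ≠ ∞ := ENNReal.inv_ne_top.2 hc0
  have h1 : potential volume (fun t => pCond d k p i t.1 t.2 y) g t.1 =
      c⁻¹ * hZero d k p i g t.1 y := by
    rw [potential, hZero, ← lintegral_const_mul' _ _ hcinv']
    refine lintegral_congr fun z => ?_
    simp only [pCond_eq_div hp hi1 hi, div_eq_mul_inv, ← hc]
    ring
  have h2 : (g t.2 : ℝ≥0∞) * pCond d k p i t.1 t.2 y =
      c⁻¹ * (g t.2 * pMarg d k p (i + 1) t.1 (join y t.2)) := by
    simp only [pCond_eq_div hp hi1 hi, div_eq_mul_inv, ← hc]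
    ring
  rw [h1, h2, ENNReal.mul_div_mul_left _ _ hcinv hcinv']

theorem isProbabilityMeasure_targetCond {f : E d k → ℝ≥0} (hf : Measurable f) (hi : i + 1 ≤ k)
    (y : E d i) (h0 : fMarg d k f i y ≠ 0) (htop : fMarg d k f i y ≠ ∞) :
    IsProbabilityMeasure (targetCond d k f i y) := by
  refine ⟨?_⟩
  rw [targetCond, withDensity_apply _ MeasurableSet.univ, Measure.restrict_univ]
  simp only [fCond, div_eq_mul_inv]
  rw [lintegral_mul_const' _ _ (ENNReal.inv_ne_top.2 h0)]
  simp only [fMarg] at h0 htop ⊢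
  rw [lintegral_join_glue hi y hf.coe_nnreal_ennreal]
  exact ENNReal.mul_inv_cancel h0 htop

theorem isProbabilityMeasure_sourceCond {μ : Measure (E d k)} [IsFiniteMeasure μ]
    {f : E d k → ℝ≥0} {h : (j : ℕ) → E d j → ℝ≥0} (hi : i + 1 ≤ k) {y : E d i}
    (hprob : IsProbabilityMeasure (piCond d k p μ f h i (Nat.le_of_succ_le hi) y)) :
    IsProbabilityMeasure (sourceCond d k p μ f h i hi y) := by
  have : IsMarkovKernel (muCond μ i hi) := by unfold muCond; infer_instance
  rw [sourceCond]
  exact Measure.isProbabilityMeasure_map continuous_join.measurable.aemeasurable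

/-- An infinite marginal density would make the prefactor `0` and annihilate the measure. -/
theorem fMarg_ne_top_of_isProbabilityMeasure {μ : Measure (E d k)} {f : E d k → ℝ≥0}
    {h : (j : ℕ) → E d j → ℝ≥0} (hi : i ≤ k) {y : E d i}
    (hprob : IsProbabilityMeasure (piCond d k p μ f h i hi y)) : fMarg d k f i y ≠ ∞ := by
  intro htop
  have h1 := hprob.measure_univ
  simp [piCond, htop] at h1

end Densities

end

end CondSchrodinger

open CondSchrodinger in
/-- With `i ≥ 1`, `i + 1 ≤ k`, this is the step from level `i` to level `i + 1`. -/
theorem proposition2p1 (k : ℕ) (hk : 2 ≤ k) (d : ℕ → ℕ) (hd : ∀ j, 1 ≤ j → j ≤ k → 1 ≤ d j)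
    (p : E d k → E d k → ℝ) (μ ν : Measure (E d k)) [IsProbabilityMeasure μ]
    [IsProbabilityMeasure ν] (f : E d k → ℝ≥0)
    (hp : DensityAssumption d k p) (hconv : ConvexityAssumption d k p) (hν : HasDensity ν f)
    (i : ℕ) (hi1 : 1 ≤ i) (hi : i + 1 ≤ k)
    -- the functions `h_1, …, h_i` of the previous levels
    (h : (j : ℕ) → E d j → ℝ≥0)
    (hsec : ∀ j < i, ∀ y : E d j, Measurable (fun z : B d (j + 1) => h (j + 1) (join y z)))
    (y : E d i) (hy : 0 < fMarg d k f i y)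
    (hprob : IsProbabilityMeasure (piCond d k p μ f h i (Nat.le_of_succ_le hi) y)) :
    -- existence, and uniqueness up to a positive factor for the given `y`
    (∃ g, IsSolution d k p f i y (sourceCond d k p μ f h i hi y) g ∧
      ∀ g', IsSolution d k p f i y (sourceCond d k p μ f h i hi y) g' ↔
        Measurable g' ∧ ∃ c : ℝ≥0, 0 < c ∧ g' =ᵐ[volume] fun z => c * g z) ∧
    ∀ g, IsSolution d k p f i y (sourceCond d k p μ f h i hi y) g →
      -- prescribed marginals
      planCond d k p i y (sourceCond d k p μ f h i hi y) g ∈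
        couplings (sourceCond d k p μ f h i hi y) (targetCond d k f i y) ∧
      -- unique minimality for the entropy relative to the conditional law of `π_{0,i+1}` given `y`,
      -- for those `y` at which the regular conditional probabilities have their explicit form
      ((∀ j, 1 ≤ j → j ≤ i → Measurable (h j)) →
        ∀ (κ₁ : Kernel (E d i) (E d (i + 1))) (κ₀ : Kernel (E d i) (E d (i + 1) × B d (i + 1))),
          IsSourceVersion d k p μ h i hi κ₁ → IsPi0Version d k p μ h i hi κ₀ →
          κ₀ y = ((κ₁ y).prod volume).withDensity (fun q => pCond d k p i q.1 q.2 y) →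
          κ₁ y = sourceCond d k p μ f h i hi y →
          entropyValue (sourceCond d k p μ f h i hi y) (targetCond d k f i y) (κ₀ y) < ∞ →
          IsUniqueMinimizer (sourceCond d k p μ f h i hi y) (targetCond d k f i y) (κ₀ y)
            (planCond d k p i y (sourceCond d k p μ f h i hi y) g)) := by
  have hQ : IsProbabilityMeasure (sourceCond d k p μ f h i hi y) :=
    isProbabilityMeasure_sourceCond hi hprob
  set Q := sourceCond d k p μ f h i hi y with hQdef
  have hN : IsProbabilityMeasure (targetCond d k f i y) :=
    isProbabilityMeasure_targetCond hν.1 hi y hy.ne'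
      (fMarg_ne_top_of_isProbabilityMeasure _ hprob)
  have hK := hp.measurable_pCond hi1 hi y
  have hK0 : ∀ t : E d (i + 1) × B d (i + 1), pCond d k p i t.1 t.2 y ≠ 0 := fun t =>
    hp.pCond_ne_zero hi1 hi _ _ _
  have hKtop : ∀ t : E d (i + 1) × B d (i + 1), pCond d k p i t.1 t.2 y ≠ ∞ := fun t =>
    hp.pCond_ne_top hi1 hi _ _ _
  have hiff : ∀ g, IsSolution d k p f i y Q g ↔
      IsSchrodinger volume Q (targetCond d k f i y) (fun t => pCond d k p i t.1 t.2 y) g :=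
    fun g => Iff.rfl
  refine ⟨?_, fun g hg => ⟨?_, ?_⟩⟩
  · obtain ⟨g, hgm, hg⟩ := exists_schrodinger_solution volume Q (targetCond d k f i y)
      (withDensity_absolutelyContinuous _ _) (hp.continuous_toReal_pCond hi1 hi y)
      (fun t => ENNReal.toReal_pos (hK0 t) (hKtop t))
    simp only [ENNReal.ofReal_toReal (hp.pCond_ne_top hi1 hi _ _ _)] at hg
    have hsol : IsSchrodinger volume Q (targetCond d k f i y)
      (fun t => pCond d k p i t.1 t.2 y) g := ⟨hgm, hg⟩
    refine ⟨g, hsol, fun g' => ⟨fun hg' => ⟨hg'.1, ?_⟩, ?_⟩⟩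
    · exact hsol.unique hK hK0 hKtop ((hiff g').1 hg')
    · rintro ⟨hg'm, c, hc, heq⟩
      exact hsol.of_ae_eq_mul hg'm hc heq
  · rw [hp.planCond_eq hi1 hi]
    exact ((hiff g).1 hg).plan_mem_couplings hK
  · intro _ κ₁ κ₀ _ _ hκ₀ hκ₁ hfin
    -- At this `y` the reference law is `p(x, z | y) Q(dx) dz`, the one treated by
    -- `IsSchrodinger.isUniqueMinimizer`.
    rw [hκ₁] at hκ₀
    rw [hκ₀] at hfin ⊢
    rw [hp.planCond_eq hi1 hi]
    exact ((hiff g).1 hg).isUniqueMinimizer hK (fun x => hp.lintegral_pCond hi1 hi x y) hfin
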